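/- **Setting.** All types are Galois types. Let $(K,\preceq)$ be an abstract elementary class (AEC): a class $K$ of structures in a fixed vocabulary with a partial order $\preceq$ refining the substructure relation, both closed under isomorphisms, closed under unions of $\preceq$-increasing continuous sequences (the union is in $K$ and $\preceq$-extends every member), satisfying smoothness (if all members of the sequence are $\preceq N$, so is the union), coherence ($M_0\subseteq M_1$, $M_0\preceq N$, $M_1\preceq N$ imply $M_0\preceq M_1$) and having an $LST$-number, the least $\kappa$ such that every subset $A$ of any $N\in K$ lies in some $M\preceq N$ with $\|M\|\le\kappa+|A|$. An *AEC in $\mu$* is defined in the same way, with all models of cardinality $\mu$, only sequences of length $<\mu^+$, and no $LST$ requirement. An embedding $f:M\to N$ is an isomorphism of $M$ onto some $f[M]\preceq N$. For $M\preceq N_i$, $a_i\in N_i-M$, put $(M,N_1,a_1)E^*(M,N_2,a_2)$ if there are $M_3\in K$ and embeddings $f_i:N_i\to M_3$ fixing $M$ pointwise with $f_1(a_1)=f_2(a_2)$; $tp(a,M,N)$ is the class of $(M,N,a)$ modulo the transitive closure of $E^*$, and $S(M)$ is the set of these types. $K_\mu$ is the class of models of cardinality $\mu$. **Frames.** Let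 $S^{bs}$ assign to each $M\in K_\mu$ a set $S^{bs}(M)\subseteq S(M)$ of *basic* types, and let $\mathrm{nf}$ be a relation on quadruples $(M_0,a,M_1,M_3)$ such that $\mathrm{nf}(M_0,a,M_1,M_3)$ implies $M_0\preceq M_1\preceq M_3$ in $K_\mu$, $a\in M_3-M_1$, and $tp(a,M_n,M_3)\in S^{bs}(M_n)$ for $n=0,1$. A type $p\in S(M_1)$ *does not fork over* $M_0$ if $\mathrm{nf}(M_0,a,M_1,M_3)$ for some $(M_1,M_3,a)\in p$. The *frame axioms in $\mu$* say (all models being in $K_\mu$): - there is no $\preceq$-maximal model; $S^{bs}$ and $\mathrm{nf}$ are closed under isomorphisms; - *density*: if $M\preceq N$, $M\ne N$, then $tp(a,M,N)\in S^{bs}(M)$ for some $a\in N-M$; - *monotonicity*: if $\mathrm{nf}(M_0,a,M_1,M_3)$, $M_0\preceq M_0'\preceq M_1'\preceq M_1\preceq M_3\preceq M_3'$ and $M_1'\cup\{a\}\subseteq M_3''\preceq M_3'$, then $\mathrm{nf}(M_0',a,M_1',M_3'')$; - *local character*: if $\delta<\mu^+$ is a limit ordinal, $\langle M_\alpha:\alpha\le\delta\rangle$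 is increasing continuous and $p\in S^{bs}(M_\delta)$, then $p$ does not fork over $M_\alpha$ for some $\alpha<\delta$; - *uniqueness*: if $M\preceq N$, $p,q\in S(N)$ do not fork over $M$ and $p\restriction M=q\restriction M$, then $p=q$; - *symmetry*: if $M_0\preceq M_1\preceq M_3$, $a_1\in M_1-M_0$, $tp(a_1,M_0,M_3)\in S^{bs}(M_0)$ and $\mathrm{nf}(M_0,a_2,M_1,M_3)$, then there are $M_2,M_3'$ with $M_0\preceq M_2\preceq M_3'$, $M_3\preceq M_3'$, $a_2\in M_2$ and $\mathrm{nf}(M_0,a_1,M_2,M_3')$; - *extension*: if $M\preceq N$ and $p\in S^{bs}(M)$, some $q\in S^{bs}(N)$ extends $p$ and does not fork over $M$; - *continuity*: if $\delta<\mu^+$ is a limit ordinal, $\langle M_\alpha:\alpha\le\delta\rangle$ is increasing continuous, $p\in S(M_\delta)$ and $p\restriction M_\alpha$ does not fork over $M_0$ for every $\alpha<\delta$, then $p\in S^{bs}(M_\delta)$ and $p$ does not fork over $M_0$. Let $\lambda$ be an infinite cardinal. $\mathfrak s=(K,\preceq,S^{bs},\mathrm{nf})$ is a *semi-good non-forking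 $\lambda$-frame* if $(K,\preceq)$ is an AEC with $LST$-number at most $\lambda$, has the joint embedding and amalgamation properties in $\lambda$, the frame axioms in $\lambda$ hold, and $|S^{bs}(M)|\le\lambda^+$ for every $M\in K_\lambda$. A quadruple $(K,\preceq,S^{bs},\mathrm{nf})$ is a *good non-forking $\mu$-frame minus joint embedding and amalgamation* if $(K,\preceq)$ is an AEC in $\mu$, the frame axioms in $\mu$ hold, and $|S^{bs}(M)|\le\mu$ for every $M\in K_\mu$. **The derived frame.** For models of cardinality at least $\lambda$, $\mathrm{nf}^{\ge\lambda}(M_0,a,M_1,M_2)$ means that $M_0\preceq M_1\preceq M_2$, $a\in M_2-M_1$, and there is $N_0\in K_\lambda$, $N_0\preceq M_0$, such that for each $N\in K_\lambda$ with $N_0\preceq N\preceq M_1$ there is $M'\in K_\lambda$ with $N\cup\{a\}\subseteq M'\preceq M_2$ and $\mathrm{nf}(N_0,a,N,M')$. A type $p\in S(M_1)$ does not fork over $M_0$ if $\mathrm{nf}^{\ge\lambda}(M_0,a,M_1,M_2)$ for some $(M_1,M_2,a)\in p$. For $M\in K_{\lambda^+}$, $S^{bs}_{\lambda^+}(M)$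 is the set of types over $M$ that do not fork over some $N\in K_\lambda$ with $N\preceq M$; $\mathrm{nf}_{\lambda^+}$ is $\mathrm{nf}^{\ge\lambda}$ restricted to models of cardinality $\lambda^+$. Put $\mathfrak s_{\lambda^+}=(K_{\lambda^+},\preceq\restriction K_{\lambda^+},S^{bs}_{\lambda^+},\mathrm{nf}_{\lambda^+})$. **Tameness.** *$(\lambda,\lambda^+)$-tameness for non-forking types*: for all $M_0\preceq M_1$, $M_0\preceq M_2$ in $K_{\lambda^+}$ and $a_i\in M_i-M_0$ ($i=1,2$), if for some $N\in K_\lambda$ with $N\preceq M_0$ we have $tp(a_1,N,M_1)=tp(a_2,N,M_2)$ and the types $tp(a_1,M_0,M_1)$, $tp(a_2,M_0,M_2)$ do not fork over $N$, then $tp(a_1,M_0,M_1)=tp(a_2,M_0,M_2)$. **Continuity of independence.** $\langle a_0,a_1\rangle$ is *independent* in $(M,N)$, where $M\preceq N$, if $a_0,a_1\in N-M$ and there are $M=M_0\preceq M_1\preceq M_2\preceq N^+$ with $N\preceq N^+$, $a_i\in M_{i+1}-M_i$ and $tp(a_i,M_i,M_{i+1})$ not forking over $M$, for $i=0,1$.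 *$(\lambda,\lambda^+)$-continuity of independence of sequences of length $2$*: whenever $M\preceq N$ are in $K_{\lambda^+}$ and $\langle M_\alpha:\alpha<\lambda^+\rangle$ is a filtration of $M$ (an increasing continuous sequence of models in $K_\lambda$ with union $M$), if $\langle a_0,a_1\rangle$ is independent in $(M_\alpha,N)$ for each $\alpha<\lambda^+$, then it is independent in $(M,N)$. **Theorem.** Let $\lambda$ be an infinite cardinal and $\mathfrak s=(K,\preceq,S^{bs},\mathrm{nf})$ a semi-good non-forking $\lambda$-frame for which $(\lambda,\lambda^+)$-continuity of independence of sequences of length $2$ holds. Then $\mathfrak s_{\lambda^+}$ satisfies the symmetry axiom. If, moreover, $(\lambda,\lambda^+)$-tameness for non-forking types holds, then $\mathfrak s_{\lambda^+}$ is a good non-forking $\lambda^+$-frame minus the joint embedding and amalgamation properties. -/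

import Mathlib

open Cardinal
open scoped FirstOrder

universe u

namespace AEC

/-- An `L`-structure whose universe is a set (a small class of sets), so that inclusion of
structures, unions of increasing chains and so on have their literal meaning. -/
structure SetModel (L : FirstOrder.Language.{u, u}) where
  carrier : Set ZFSet.{u}
  small : Small.{u} carrier
  str : L.Structure carrier

attribute [instance] SetModel.small SetModel.str

namespace SetModel

variable {L : FirstOrder.Language.{u, u}}

/-- The cardinality `‖M‖` of (the universe of) `M`. -/
noncomputable def card (M : SetModel L) : Cardinal.{u} := #(Shrink.{u} M.carrier)

/-- `M` is a substructure of `N`. -/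
def IsSub (M N : SetModel L) : Prop :=
  ∃ e : M.carrier ↪[L] N.carrier, ∀ x, (e x : ZFSet.{u}) = x

/-- The restriction of `f` to `M` is an isomorphism of `M` onto `N` (in other words, `N = f[M]`). -/
def IsIso (f : ZFSet.{u} → ZFSet.{u}) (M N : SetModel L) : Prop :=
  ∃ e : M.carrier ≃[L] N.carrier, ∀ x : M.carrier, (e x : ZFSet.{u}) = f x

theorem IsIso.card_eq {f : ZFSet.{u} → ZFSet.{u}} {M N : SetModel L} (h : IsIso f M N) :
    M.card = N.card := by
  obtain ⟨e, -⟩ := h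
  exact Cardinal.mk_congr
    ((equivShrink M.carrier).symm.trans (e.toEquiv.trans (equivShrink N.carrier)))

theorem IsSub.subset {M N : SetModel L} (h : IsSub M N) : M.carrier ⊆ N.carrier := by
  obtain ⟨e, he⟩ := h
  intro x hx
  have := (e ⟨x, hx⟩).2
  rw [he ⟨x, hx⟩] at this
  exact this

/-- `U` is the union of the structures `M α`, `α < δ`. -/
def IsUnion (M : Ordinal.{u} → SetModel L) (δ : Ordinal.{u}) (U : SetModel L) : Prop :=
  (∀ α < δ, IsSub (M α) U) ∧ ∀ x, x ∈ U.carrier ↔ ∃ α < δ, x ∈ (M α).carrier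

end SetModel

open SetModel

/-- A class `K` of `L`-structures together with a partial order `⪯` on it that refines the
substructure relation, both closed under isomorphisms. (Antisymmetry follows from `le_sub`.) -/
structure AbstractClass (L : FirstOrder.Language.{u, u}) where
  Mem : SetModel L → Prop
  le : SetModel L → SetModel L → Prop
  mem_of_le : ∀ {M N}, le M N → Mem M ∧ Mem N
  le_sub : ∀ {M N}, le M N → IsSub M N
  le_refl : ∀ {M}, Mem M → le M M
  le_trans : ∀ {M₀ M₁ M₂}, le M₀ M₁ → le M₁ M₂ → le M₀ M₂
  mem_iso : ∀ {f M N}, IsIso f M N → Mem M → Mem N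
  le_iso : ∀ {f M N M' N'}, le M N → IsIso f N N' → IsIso f M M' → le M' N'

namespace AbstractClass

variable {L : FirstOrder.Language.{u, u}} (K : AbstractClass L)

/-- `M ∈ K_μ`. -/
def MemCard (μ : Cardinal.{u}) (M : SetModel L) : Prop := K.Mem M ∧ M.card = μ

/-- The pair `(K_μ, ⪯ ↾ K_μ)`. -/
def atCard (μ : Cardinal.{u}) : AbstractClass L where
  Mem := K.MemCard μ
  le M N := K.le M N ∧ M.card = μ ∧ N.card = μ
  mem_of_le h := ⟨⟨(K.mem_of_le h.1).1, h.2.1⟩, ⟨(K.mem_of_le h.1).2, h.2.2⟩⟩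
  le_sub h := K.le_sub h.1
  le_refl h := ⟨K.le_refl h.1, h.2, h.2⟩
  le_trans h₁ h₂ := ⟨K.le_trans h₁.1 h₂.1, h₁.2.1, h₂.2.2⟩
  mem_iso h hM := ⟨K.mem_iso h hM.1, h.card_eq.symm.trans hM.2⟩
  le_iso h hN hM := ⟨K.le_iso h.1 hN hM, hM.card_eq.symm.trans h.2.1, hN.card_eq.symm.trans h.2.2⟩

/-- `⟨M α : α < δ⟩` is a `⪯`-increasing continuous sequence of models in `K`. -/
def IsIncCont (δ : Ordinal.{u}) (M : Ordinal.{u} → SetModel L) : Prop :=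
  (∀ α β, α ≤ β → β < δ → K.le (M α) (M β)) ∧
    ∀ γ < δ, Order.IsSuccLimit γ → IsUnion M γ (M γ)

/-- Closure under unions of increasing continuous sequences whose (limit) length satisfies `P`. -/
def ClosedUnderUnions (P : Ordinal.{u} → Prop) : Prop :=
  ∀ (δ : Ordinal.{u}) (M : Ordinal.{u} → SetModel L) (U : SetModel L),
    P δ → Order.IsSuccLimit δ → K.IsIncCont δ M → IsUnion M δ U →
      K.Mem U ∧ ∀ α < δ, K.le (M α) U

/-- Smoothness for increasing continuous sequences whose (limit) length satisfies `P`. -/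
def Smooth (P : Ordinal.{u} → Prop) : Prop :=
  ∀ (δ : Ordinal.{u}) (M : Ordinal.{u} → SetModel L) (U N : SetModel L),
    P δ → Order.IsSuccLimit δ → K.IsIncCont δ M → IsUnion M δ U →
      (∀ α < δ, K.le (M α) N) → K.le U N

/-- If `M₀ ⊆ M₁`, `M₀ ⪯ N` and `M₁ ⪯ N`, then `M₀ ⪯ M₁`. -/
def Coherent : Prop :=
  ∀ M₀ M₁ N : SetModel L, K.le M₀ N → K.le M₁ N → IsSub M₀ M₁ → K.le M₀ M₁

/-- The LST-number of `K` is at most `κ`. (The LST-number is the least `κ` with this property;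
the property is inherited by larger cardinals.) -/
def HasLST (κ : Cardinal.{u}) : Prop :=
  ∀ (N : SetModel L) (A : Set ZFSet.{u}), K.Mem N → A ⊆ N.carrier →
    ∃ M, K.le M N ∧ A ⊆ M.carrier ∧
      Cardinal.lift.{u + 1} M.card ≤ Cardinal.lift.{u + 1} κ + #A

/-- `(K, ⪯)` is an abstract elementary class. -/
structure IsAEC : Prop where
  union : K.ClosedUnderUnions fun _ => True
  smooth : K.Smooth fun _ => True
  coherent : K.Coherent
  lst : ∃ κ : Cardinal.{u}, K.HasLST κ

/-- `(K, ⪯)` is an AEC in `μ`. -/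
structure IsAECIn (μ : Cardinal.{u}) : Prop where
  card_eq : ∀ M, K.Mem M → M.card = μ
  union : K.ClosedUnderUnions fun δ => δ < (Order.succ μ).ord
  smooth : K.Smooth fun δ => δ < (Order.succ μ).ord
  coherent : K.Coherent

/-- `f` restricts to an embedding (of `K`) of `M` into `N`, that is, `f[M] ⪯ N`. -/
def IsEmb (f : ZFSet.{u} → ZFSet.{u}) (M N : SetModel L) : Prop :=
  ∃ M', IsIso f M M' ∧ K.le M' N

/-- `f` is an embedding of `M` into `N` that fixes `M₀` pointwise. -/
def IsEmbOver (M₀ : SetModel L) (f : ZFSet.{u} → ZFSet.{u}) (M N : SetModel L) : Prop :=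
  K.IsEmb f M N ∧ ∀ x ∈ M₀.carrier, f x = x

/-- The joint embedding property in `μ`. -/
def JointEmbedding (μ : Cardinal.{u}) : Prop :=
  ∀ M₁ M₂, K.MemCard μ M₁ → K.MemCard μ M₂ →
    ∃ M₃ f₁ f₂, K.MemCard μ M₃ ∧ K.IsEmb f₁ M₁ M₃ ∧ K.IsEmb f₂ M₂ M₃

/-- The amalgamation property in `μ`. -/
def Amalgamation (μ : Cardinal.{u}) : Prop :=
  ∀ M₀ M₁ M₂, K.MemCard μ M₀ → K.MemCard μ M₁ → K.MemCard μ M₂ → K.le M₀ M₁ → K.le M₀ M₂ →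
    ∃ M₃ f₁ f₂, K.MemCard μ M₃ ∧ K.IsEmbOver M₀ f₁ M₁ M₃ ∧ K.IsEmbOver M₀ f₂ M₂ M₃

/-- There is no maximal model of cardinality `μ`. -/
def NoMaximal (μ : Cardinal.{u}) : Prop :=
  ∀ M, K.MemCard μ M → ∃ N, K.MemCard μ N ∧ K.le M N ∧ M.carrier ≠ N.carrier

/-- `⟨M α : α < λ⁺⟩` is a filtration of `N` (a model of cardinality `λ⁺`). -/
def IsFiltration (lam : Cardinal.{u}) (M : Ordinal.{u} → SetModel L) (N : SetModel L) : Prop :=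
  K.IsIncCont (Order.succ lam).ord M ∧ (∀ α < (Order.succ lam).ord, (M α).card = lam) ∧
    IsUnion M (Order.succ lam).ord N

/-- The triples `(M, N, a)` with `M ⪯ N` and `a ∈ N - M`. -/
structure Triple (M : SetModel L) where
  top : SetModel L
  elt : ZFSet.{u}
  le_top : K.le M top
  elt_mem : elt ∈ top.carrier
  elt_notMem : elt ∉ M.carrier

variable {K} in
/-- The relation `E*`. -/
def Triple.EStar {M : SetModel L} (t₁ t₂ : K.Triple M) : Prop :=
  ∃ M₃ f₁ f₂, K.IsEmbOver M f₁ t₁.top M₃ ∧ K.IsEmbOver M f₂ t₂.top M₃ ∧ f₁ t₁.elt = f₂ t₂.elt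

/-- The (non-algebraic, Galois) types over `M`: the classes of triples modulo the equivalence
relation generated by `E*`, which is its transitive closure as `E*` is reflexive and symmetric. -/
def GType (M : SetModel L) : Type (u + 1) := Quot (Triple.EStar (K := K) (M := M))

variable {K}

/-- `tp(a, M, N)`. -/
def tp {a : ZFSet.{u}} {M N : SetModel L} (h : K.le M N) (ha : a ∈ N.carrier)
    (ha' : a ∉ M.carrier) : K.GType M :=
  Quot.mk _ ⟨N, a, h, ha, ha'⟩

/-- The restriction `p ↾ M₀` of a type `p` over `M₁` to `M₀ ⪯ M₁`. -/
def GType.restrict {M₀ M₁ : SetModel L} (h : K.le M₀ M₁) : K.GType M₁ → K.GType M₀ :=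
  Quot.map
    (fun t => ⟨t.top, t.elt, K.le_trans h t.le_top, t.elt_mem,
      fun h' => t.elt_notMem ((K.le_sub h).subset h')⟩)
    (by
      rintro t₁ t₂ ⟨M₃, f₁, f₂, h₁, h₂, he⟩
      exact ⟨M₃, f₁, f₂, ⟨h₁.1, fun x hx => h₁.2 x ((K.le_sub h).subset hx)⟩,
        ⟨h₂.1, fun x hx => h₂.2 x ((K.le_sub h).subset hx)⟩, he⟩)

/-- The type in `(K, ⪯)` determined by a type in `(K_μ, ⪯ ↾ K_μ)`: both are represented by the
same triples. -/
def GType.ofAtCard {μ : Cardinal.{u}} {M : SetModel L} : (K.atCard μ).GType M → K.GType M :=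
  Quot.map (fun t => ⟨t.top, t.elt, t.le_top.1, t.elt_mem, t.elt_notMem⟩)
    (by
      rintro t₁ t₂ ⟨M₃, f₁, f₂, ⟨⟨N₁, hi₁, hl₁⟩, hf₁⟩, ⟨⟨N₂, hi₂, hl₂⟩, hf₂⟩, he⟩
      exact ⟨M₃, f₁, f₂, ⟨⟨N₁, hi₁, hl₁.1⟩, hf₁⟩, ⟨⟨N₂, hi₂, hl₂.1⟩, hf₂⟩, he⟩)

end AbstractClass

/-- The data `(K, ⪯, S^bs, dnf)` of a frame; `nf M₀ a M₁ M₃` is the non-forking relation. -/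
structure PreFrame (L : FirstOrder.Language.{u, u}) where
  K : AbstractClass L
  bs : (M : SetModel L) → Set (K.GType M)
  nf : SetModel L → ZFSet.{u} → SetModel L → SetModel L → Prop

namespace PreFrame

variable {L : FirstOrder.Language.{u, u}} (s : PreFrame L)

/-- The type `p` over `M₁` does not fork over `M₀`. -/
def DoesNotFork {M₁ : SetModel L} (p : s.K.GType M₁) (M₀ : SetModel L) : Prop :=
  ∃ t : s.K.Triple M₁, Quot.mk _ t = p ∧ s.nf M₀ t.elt M₁ t.top

/-- `S^bs` is closed under isomorphisms. -/
def BasicIso (μ : Cardinal.{u}) : Prop :=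
  ∀ (f : ZFSet.{u} → ZFSet.{u}) (a : ZFSet.{u}) (M N M' N' : SetModel L)
    (h : s.K.le M N) (ha : a ∈ N.carrier) (ha' : a ∉ M.carrier)
    (h' : s.K.le M' N') (hb : f a ∈ N'.carrier) (hb' : f a ∉ M'.carrier),
    s.K.MemCard μ M → s.K.MemCard μ N → IsIso f N N' → IsIso f M M' →
      AbstractClass.tp h ha ha' ∈ s.bs M → AbstractClass.tp h' hb hb' ∈ s.bs M'

/-- Density of the basic types. -/
def Density (μ : Cardinal.{u}) : Prop :=
  ∀ (M N : SetModel L) (h : s.K.le M N), s.K.MemCard μ M → s.K.MemCard μ N →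
    M.carrier ≠ N.carrier →
      ∃ (a : ZFSet.{u}) (ha : a ∈ N.carrier) (ha' : a ∉ M.carrier),
        AbstractClass.tp h ha ha' ∈ s.bs M

/-- `|S^bs(M)| ≤ κ` for every model `M` of cardinality `μ`. -/
def BasicStability (μ κ : Cardinal.{u}) : Prop :=
  ∀ M, s.K.MemCard μ M → #(s.bs M) ≤ Cardinal.lift.{u + 1} κ

/-- `nf` relates to models of cardinality `μ` and to basic types. -/
def NfBasic (μ : Cardinal.{u}) : Prop :=
  ∀ M₀ a M₁ M₃, s.nf M₀ a M₁ M₃ →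
    s.K.MemCard μ M₀ ∧ s.K.MemCard μ M₁ ∧ s.K.MemCard μ M₃ ∧
    ∃ (h₀₁ : s.K.le M₀ M₁) (h₁₃ : s.K.le M₁ M₃) (ha : a ∈ M₃.carrier) (ha' : a ∉ M₁.carrier),
      AbstractClass.tp h₁₃ ha ha' ∈ s.bs M₁ ∧
      (AbstractClass.tp h₁₃ ha ha').restrict h₀₁ ∈ s.bs M₀

/-- `nf` is closed under isomorphisms. -/
def NfIso : Prop :=
  ∀ (f : ZFSet.{u} → ZFSet.{u}) (a : ZFSet.{u}) (M₀ M₁ M₃ N₀ N₁ N₃ : SetModel L),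
    IsIso f M₀ N₀ → IsIso f M₁ N₁ → IsIso f M₃ N₃ → s.nf M₀ a M₁ M₃ → s.nf N₀ (f a) N₁ N₃

/-- Monotonicity. -/
def Monotonicity (μ : Cardinal.{u}) : Prop :=
  ∀ (a : ZFSet.{u}) (M₀ M₀' M₁' M₁ M₃ M₃' M₃'' : SetModel L),
    s.K.MemCard μ M₀' → s.K.MemCard μ M₁' → s.K.MemCard μ M₃' → s.K.MemCard μ M₃'' →
    s.K.le M₀ M₀' → s.K.le M₀' M₁' → s.K.le M₁' M₁ → s.K.le M₁ M₃ → s.K.le M₃ M₃' →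
    s.K.le M₃'' M₃' → M₁'.carrier ⊆ M₃''.carrier → a ∈ M₃''.carrier →
      s.nf M₀ a M₁ M₃ → s.nf M₀' a M₁' M₃''

/-- Local character. -/
def LocalCharacter (μ : Cardinal.{u}) : Prop :=
  ∀ (δ : Ordinal.{u}) (M : Ordinal.{u} → SetModel L),
    δ < (Order.succ μ).ord → Order.IsSuccLimit δ → s.K.IsIncCont (δ + 1) M →
    (∀ α ≤ δ, (M α).card = μ) →
      ∀ p ∈ s.bs (M δ), ∃ α < δ, s.DoesNotFork p (M α)

/-- Uniqueness of the non-forking extension. -/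
def Uniqueness (μ : Cardinal.{u}) : Prop :=
  ∀ (M N : SetModel L) (h : s.K.le M N), s.K.MemCard μ M → s.K.MemCard μ N →
    ∀ p q : s.K.GType N, s.DoesNotFork p M → s.DoesNotFork q M →
      p.restrict h = q.restrict h → p = q

/-- Symmetry. -/
def Symmetry (μ : Cardinal.{u}) : Prop :=
  ∀ (M₀ M₁ M₃ : SetModel L) (a₁ a₂ : ZFSet.{u}) (h₀₁ : s.K.le M₀ M₁) (h₁₃ : s.K.le M₁ M₃)
    (ha : a₁ ∈ M₁.carrier) (ha' : a₁ ∉ M₀.carrier),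
    s.K.MemCard μ M₀ → s.K.MemCard μ M₁ → s.K.MemCard μ M₃ →
    AbstractClass.tp (s.K.le_trans h₀₁ h₁₃) ((s.K.le_sub h₁₃).subset ha) ha' ∈ s.bs M₀ →
    s.nf M₀ a₂ M₁ M₃ →
      ∃ M₂ M₃', s.K.MemCard μ M₂ ∧ s.K.MemCard μ M₃' ∧ s.K.le M₀ M₂ ∧ s.K.le M₂ M₃' ∧
        s.K.le M₃ M₃' ∧ a₂ ∈ M₂.carrier ∧ s.nf M₀ a₁ M₂ M₃'

/-- Extension: existence of non-forking extensions. -/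
def Extension (μ : Cardinal.{u}) : Prop :=
  ∀ (M N : SetModel L) (h : s.K.le M N), s.K.MemCard μ M → s.K.MemCard μ N →
    ∀ p ∈ s.bs M, ∃ q ∈ s.bs N, s.DoesNotFork q M ∧ q.restrict h = p

/-- Continuity. -/
def Continuity (μ : Cardinal.{u}) : Prop :=
  ∀ (δ : Ordinal.{u}) (M : Ordinal.{u} → SetModel L),
    δ < (Order.succ μ).ord → Order.IsSuccLimit δ → s.K.IsIncCont (δ + 1) M →
    (∀ α ≤ δ, (M α).card = μ) →
      ∀ p : s.K.GType (M δ),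
        (∀ α < δ, ∃ h : s.K.le (M α) (M δ), s.DoesNotFork (p.restrict h) (M 0)) →
          p ∈ s.bs (M δ) ∧ s.DoesNotFork p (M 0)

/-- The axioms of a frame in `μ`, with at most `κ` basic types over each model of cardinality `μ`,
except for the requirement on `(K, ⪯)` to be an AEC (in `μ`) with joint embedding and
amalgamation. -/
structure FrameAxioms (μ κ : Cardinal.{u}) : Prop where
  noMaximal : s.K.NoMaximal μ
  basicIso : s.BasicIso μ
  density : s.Density μ
  basicStability : s.BasicStability μ κ
  nfBasic : s.NfBasic μ
  nfIso : s.NfIso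
  monotonicity : s.Monotonicity μ
  localCharacter : s.LocalCharacter μ
  uniqueness : s.Uniqueness μ
  symmetry : s.Symmetry μ
  extension : s.Extension μ
  continuity : s.Continuity μ

/-- `s` is a semi-good non-forking `λ`-frame. -/
structure IsSemiGoodFrame (lam : Cardinal.{u}) : Prop where
  isAEC : s.K.IsAEC
  lst : s.K.HasLST lam
  jointEmbedding : s.K.JointEmbedding lam
  amalgamation : s.K.Amalgamation lam
  frame : s.FrameAxioms lam (Order.succ lam)

/-- `s` is a good non-forking `μ`-frame (of the second version: `(K, ⪯)` is an AEC in `μ`)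
minus the joint embedding and amalgamation properties. -/
structure IsGoodFrameMinusJEPAP (μ : Cardinal.{u}) : Prop where
  isAECIn : s.K.IsAECIn μ
  frame : s.FrameAxioms μ μ

/-- The non-forking relation `nf^{≥ λ}` on models of cardinality at least `λ`. The last clause says
that `tp(a, N, M₂)` does not fork over `N₀`, through a model `M' ⪯ M₂` of cardinality `λ`
with `N ∪ {a} ⊆ M'`. -/
def nfGE (lam : Cardinal.{u}) (M₀ : SetModel L) (a : ZFSet.{u}) (M₁ M₂ : SetModel L) : Prop :=
  lam ≤ M₀.card ∧ lam ≤ M₁.card ∧ lam ≤ M₂.card ∧ s.K.le M₀ M₁ ∧ s.K.le M₁ M₂ ∧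
    a ∈ M₂.carrier ∧ a ∉ M₁.carrier ∧
    ∃ N₀, s.K.MemCard lam N₀ ∧ s.K.le N₀ M₀ ∧
      ∀ N, s.K.MemCard lam N → s.K.le N₀ N → s.K.le N M₁ →
        ∃ M', s.K.MemCard lam M' ∧ s.K.le N M' ∧ a ∈ M'.carrier ∧ s.K.le M' M₂ ∧ s.nf N₀ a N M'

/-- The type `p` over `M₁` does not fork over `M₀`, for models of cardinality at least `λ`. -/
def DoesNotForkGE (lam : Cardinal.{u}) {M₁ : SetModel L} (p : s.K.GType M₁) (M₀ : SetModel L) :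
    Prop :=
  ∃ t : s.K.Triple M₁, Quot.mk _ t = p ∧ s.nfGE lam M₀ t.elt M₁ t.top

/-- The basic types over a model `M` of cardinality greater than `λ`. -/
def bsGT (lam : Cardinal.{u}) (M : SetModel L) : Set (s.K.GType M) :=
  {p | ∃ N, s.K.MemCard lam N ∧ s.K.le N M ∧ s.DoesNotForkGE lam p N}

/-- `s_{λ⁺} = (K_{λ⁺}, ⪯ ↾ K_{λ⁺}, S^bs_{λ⁺}, nf_{λ⁺})`. -/
noncomputable def succFrame (lam : Cardinal.{u}) : PreFrame L where
  K := s.K.atCard (Order.succ lam)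
  bs M := {p | p.ofAtCard ∈ s.bsGT lam M}
  nf M₀ a M₁ M₂ := s.nfGE lam M₀ a M₁ M₂ ∧
    M₀.card = Order.succ lam ∧ M₁.card = Order.succ lam ∧ M₂.card = Order.succ lam

/-- The `(λ, λ⁺)`-tameness for non-forking types property. -/
def TameNonForking (lam : Cardinal.{u}) : Prop :=
  ∀ (M₀ M₁ M₂ : SetModel L) (a₁ a₂ : ZFSet.{u}) (h₁ : s.K.le M₀ M₁) (h₂ : s.K.le M₀ M₂)
    (ha₁ : a₁ ∈ M₁.carrier) (ha₁' : a₁ ∉ M₀.carrier)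
    (ha₂ : a₂ ∈ M₂.carrier) (ha₂' : a₂ ∉ M₀.carrier),
    s.K.MemCard (Order.succ lam) M₀ → s.K.MemCard (Order.succ lam) M₁ →
    s.K.MemCard (Order.succ lam) M₂ →
    (∃ (N : SetModel L) (h : s.K.le N M₀), s.K.MemCard lam N ∧
      (AbstractClass.tp h₁ ha₁ ha₁').restrict h = (AbstractClass.tp h₂ ha₂ ha₂').restrict h ∧
      s.DoesNotForkGE lam (AbstractClass.tp h₁ ha₁ ha₁') N ∧
      s.DoesNotForkGE lam (AbstractClass.tp h₂ ha₂ ha₂') N) →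
    AbstractClass.tp h₁ ha₁ ha₁' = AbstractClass.tp h₂ ha₂ ha₂'

/-- `⟨Ms α, a α : α < ε⟩ ⌢ ⟨Ms ε⟩` is independent over `M`. -/
def IndepOver (lam : Cardinal.{u}) (ε : Ordinal.{u}) (Ms : Ordinal.{u} → SetModel L)
    (a : Ordinal.{u} → ZFSet.{u}) (M : SetModel L) : Prop :=
  s.K.IsIncCont (ε + 1) Ms ∧ s.K.le M (Ms 0) ∧
    ∀ α < ε, ∃ (h : s.K.le (Ms α) (Ms (α + 1))) (ha : a α ∈ (Ms (α + 1)).carrier)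
      (ha' : a α ∉ (Ms α).carrier), s.DoesNotForkGE lam (AbstractClass.tp h ha ha') M

/-- `⟨a α : α < ε⟩` is independent in `(M, M₀, N)`. -/
def IndepIn (lam : Cardinal.{u}) (ε : Ordinal.{u}) (a : Ordinal.{u} → ZFSet.{u})
    (M M₀ N : SetModel L) : Prop :=
  s.K.le M M₀ ∧ s.K.le M₀ N ∧ (∀ α < ε, a α ∈ N.carrier ∧ a α ∉ M.carrier) ∧
    ∃ (Ms : Ordinal.{u} → SetModel L) (N' : SetModel L), Ms 0 = M₀ ∧ s.IndepOver lam ε Ms a M ∧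
      s.K.le N N' ∧ s.K.le (Ms ε) N'

/-- The `(λ, λ⁺)`-continuity of independence of sequences of length `ε` property. -/
def ContinuityOfIndependence (lam : Cardinal.{u}) (ε : Ordinal.{u}) : Prop :=
  ∀ (M N : SetModel L) (Ms : Ordinal.{u} → SetModel L) (a : Ordinal.{u} → ZFSet.{u}),
    s.K.MemCard (Order.succ lam) M → s.K.MemCard (Order.succ lam) N → s.K.le M N →
    s.K.IsFiltration lam Ms M →
    (∀ α < (Order.succ lam).ord, s.IndepIn lam ε a (Ms α) (Ms α) N) →
      s.IndepIn lam ε a M M N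

end PreFrame

end AEC

/-!
The relation `nfGE` on models of cardinality at least `λ` reduces to the frame in `λ`: it depends
only on the type of the element (`nfGE_of_mk_eq`), it coincides with `nf` in cardinality `λ`
(`nfGE_iff_nf`), and over a base of cardinality `λ` it may be checked on small submodels
(`nfGE_of_forall`), so that it inherits monotonicity and transitivity (`nfGE_mono`, `nfGE_trans`);
transitivity in `λ` follows from uniqueness and extension. All transfers between cardinals use the
Löwenheim–Skolem property, so that amalgamation is needed in cardinality `λ` only.

* *Extension and the absence of maximal models.* A model `M` of cardinality `λ⁺` has a filtration.
  A basic type over its first member is prolonged along the filtration as a directed system of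
  models of cardinality `λ` (`exists_direct_limit`): extension and amalgamation in `λ` handle
  successor steps, continuity handles limits. The limit is an extension of `M` in which the type
  is realized freely from `M` (`exists_nfGE_extension`). The same construction without types
  amalgamates `M` with a model of cardinality `λ` over a model of cardinality `λ`
  (`exists_amalgam_succ`).
* *Density.* If no element of `N` outside `M` had a basic type over `M`, then an `ω`-chain of
  small models, closed under witnesses for forking, would have a union contradicting density and
  local character in `λ` (`exists_nfGE_of_ne`).
* *Local character and continuity.* A small submodel of the union of a chain is contained in a
  member of the chain, or in the union of a chain of length less than `λ⁺` of small submodels of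
  its members (`exists_reflection`); in the second case the axiom in `λ` and transitivity apply.
* *Symmetry.* If `nf(M₀, a₂, M₁, M₃)` and `a₁ ∈ M₁` has a basic type over `M₀`, then symmetry in
  `λ` shows that `⟨a₂, a₁⟩` is independent over each member of a filtration of `M₀` with a
  suitable first member (`indepIn_two`); the models given by symmetry are amalgamated with `M₃`.
  Continuity of independence yields independence over `M₀`, which is the conclusion of symmetry
  (`nfGE_symmetry`).
* *Uniqueness, extension and stability.* By tameness, a basic type over `M` is determined by its
  restriction to a small submodel over which it does not fork (`tp_eq_of_tame`). Since a
  filtration of `M` has `λ⁺` members, each with at most `λ⁺` basic types, there are at most `λ⁺`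
  basic types over `M`.
-/

namespace AEC

/-! ### Isomorphisms, substructures and unions of structures on sets -/

namespace SetModel

open FirstOrder.Language

variable {L : FirstOrder.Language.{u, u}} {M N P M' N' : SetModel L} {f g : ZFSet.{u} → ZFSet.{u}}

theorem IsSub.funMap_eq (h : IsSub M N) {n : ℕ} (F : L.Functions n) {x : Fin n → M.carrier}
    {y : Fin n → N.carrier} (hxy : ∀ i, (x i : ZFSet) = y i) :
    ((Structure.funMap F x : M.carrier) : ZFSet) = (Structure.funMap F y : N.carrier) := by
  obtain ⟨e, he⟩ := h
  rw [← he, e.map_fun]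
  congr 2
  funext i
  exact Subtype.ext ((he _).trans (hxy i))

theorem IsSub.relMap_iff (h : IsSub M N) {n : ℕ} (R : L.Relations n) {x : Fin n → M.carrier}
    {y : Fin n → N.carrier} (hxy : ∀ i, (x i : ZFSet) = y i) :
    Structure.RelMap R x ↔ Structure.RelMap R y := by
  obtain ⟨e, he⟩ := h
  rw [← e.map_rel]
  have : e ∘ x = y := funext fun i => Subtype.ext ((he _).trans (hxy i))
  rw [this]

theorem IsSub.of_inclusion (hs : M.carrier ⊆ N.carrier)
    (hf : ∀ (n : ℕ) (F : L.Functions n) (x : Fin n → M.carrier),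
      ((Structure.funMap F x : M.carrier) : ZFSet) =
        (Structure.funMap F (Set.inclusion hs ∘ x) : N.carrier))
    (hr : ∀ (n : ℕ) (R : L.Relations n) (x : Fin n → M.carrier),
      Structure.RelMap R (Set.inclusion hs ∘ x) ↔ Structure.RelMap R x) : IsSub M N :=
  ⟨{ toFun := Set.inclusion hs
     inj' := Set.inclusion_injective hs
     map_fun' := fun F x => Subtype.ext (hf _ F x)
     map_rel' := fun R x => hr _ R x }, fun _ => rfl⟩

theorem IsSub.of_subset (hM : IsSub M P) (hN : IsSub N P) (hs : M.carrier ⊆ N.carrier) :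
    IsSub M N := by
  refine IsSub.of_inclusion hs (fun n F x => ?_) fun n R x => ?_
  · exact (hM.funMap_eq F (y := Set.inclusion hM.subset ∘ x) fun i => rfl).trans
      (hN.funMap_eq F fun i => rfl).symm
  · exact (hN.relMap_iff R (y := Set.inclusion hM.subset ∘ x) fun i => rfl).trans
      (hM.relMap_iff R fun i => rfl).symm

theorem IsIso.refl (M : SetModel L) : IsIso id M M :=
  ⟨FirstOrder.Language.Equiv.refl L _, fun _ => rfl⟩

theorem IsIso.congr (h : IsIso f M N) (hfg : ∀ x ∈ M.carrier, f x = g x) : IsIso g M N := by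
  obtain ⟨e, he⟩ := h
  exact ⟨e, fun x => (he x).trans (hfg x x.2)⟩

theorem IsIso.of_fixed (hf : ∀ x ∈ M.carrier, f x = x) : IsIso f M M :=
  (IsIso.refl M).congr fun x hx => (hf x hx).symm

theorem IsIso.trans (h : IsIso f M N) (h' : IsIso g N P) : IsIso (g ∘ f) M P := by
  obtain ⟨e, he⟩ := h
  obtain ⟨e', he'⟩ := h'
  exact ⟨e'.comp e, fun x => by simp [he', he]⟩

theorem IsIso.injOn (h : IsIso f M N) : Set.InjOn f M.carrier := by
  obtain ⟨e, he⟩ := h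
  intro x hx y hy hxy
  have : e ⟨x, hx⟩ = e ⟨y, hy⟩ := Subtype.ext (by rw [he, he]; exact hxy)
  exact congrArg Subtype.val (e.injective this)

theorem IsIso.mem (h : IsIso f M N) {x : ZFSet} (hx : x ∈ M.carrier) : f x ∈ N.carrier := by
  obtain ⟨e, he⟩ := h
  rw [← he ⟨x, hx⟩]
  exact (e _).2

theorem IsIso.exists_of_mem (h : IsIso f M N) {y : ZFSet} (hy : y ∈ N.carrier) :
    ∃ x ∈ M.carrier, f x = y := by
  obtain ⟨e, he⟩ := h
  refine ⟨e.symm ⟨y, hy⟩, (e.symm ⟨y, hy⟩).2, ?_⟩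
  rw [← he, e.apply_symm_apply]

theorem IsIso.symm (h : IsIso f M N) :
    ∃ g, IsIso g N M ∧ (∀ x ∈ M.carrier, g (f x) = x) ∧ ∀ y ∈ N.carrier, f (g y) = y := by
  have h1 : ∀ x ∈ M.carrier, Function.invFunOn f M.carrier (f x) = x :=
    fun x hx => h.injOn.leftInvOn_invFunOn hx
  refine ⟨Function.invFunOn f M.carrier, ?_, h1, ?_⟩
  · obtain ⟨e, he⟩ := h
    refine ⟨e.symm, fun y => ?_⟩
    obtain ⟨x, rfl⟩ := e.surjective y
    rw [e.symm_apply_apply, he, h1 x x.2]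
  · intro y hy
    obtain ⟨x, hx, rfl⟩ := h.exists_of_mem hy
    rw [h1 x hx]

/-- An injective function transports the structure of `M` to its image. -/
theorem exists_isIso (M : SetModel L) (hf : Set.InjOn f M.carrier) : ∃ N, IsIso f M N := by
  let e : M.carrier ≃ f '' M.carrier := Equiv.Set.imageOfInjOn f M.carrier hf
  let N : SetModel L := ⟨f '' M.carrier, inferInstance, e.inducedStructure⟩
  exact ⟨N, ⟨e.inducedStructureEquiv, fun x => rfl⟩⟩

theorem IsIso.exists_isIso_of_isSub (h : IsIso f N N') (hM : IsSub M N) : ∃ M', IsIso f M M' :=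
  exists_isIso M (h.injOn.mono hM.subset)

/-- Isomorphic copies of substructures are substructures. -/
theorem IsIso.isSub (h : IsIso f N N') (h' : IsIso f M M') (hM : IsSub M N) : IsSub M' N' := by
  obtain ⟨e, he⟩ := h
  obtain ⟨e', he'⟩ := h'
  obtain ⟨i, hi⟩ := hM
  refine ⟨(e.toEmbedding.comp i).comp e'.symm.toEmbedding, fun y => ?_⟩
  obtain ⟨x, rfl⟩ := e'.surjective y
  simp [he, he', hi]

/-- The union of an increasing sequence of structures exists. -/
theorem exists_isUnion {M : Ordinal.{u} → SetModel L} {δ : Ordinal.{u}} (hδ : 0 < δ)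
    (hM : ∀ α β, α ≤ β → β < δ → IsSub (M α) (M β)) : ∃ U, IsUnion M δ U := by
  classical
  let C : Set ZFSet.{u} := ⋃ α : Set.Iio δ, (M α).carrier
  have hC : ∀ x, x ∈ C ↔ ∃ α < δ, x ∈ (M α).carrier := by
    intro x; simp [C]
  have hb : ∀ (n : ℕ) (x : Fin n → C), ∃ α < δ, ∀ i, (x i : ZFSet) ∈ (M α).carrier := by
    intro n x
    choose a ha ha' using fun i => (hC _).1 (x i).2
    rcases Nat.eq_zero_or_pos n with rfl | hn
    · exact ⟨0, hδ, fun i => i.elim0⟩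
    · have : Nonempty (Fin n) := ⟨⟨0, hn⟩⟩
      obtain ⟨j, -, hj⟩ := Finset.exists_max_image Finset.univ a Finset.univ_nonempty
      exact ⟨a j, ha j, fun i => (hM _ _ (hj i (Finset.mem_univ _)) (ha j)).subset (ha' i)⟩
  -- Each finite tuple is evaluated in a member of the sequence that contains it.
  choose b hb hb' using hb
  let str : L.Structure C :=
    { funMap := fun {n} F x =>
        ⟨(Structure.funMap F (fun i => (⟨x i, hb' n x i⟩ : (M (b n x)).carrier)) :
            (M (b n x)).carrier), (hC _).2 ⟨_, hb n x, Subtype.mem _⟩⟩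
      RelMap := fun {n} R x =>
        Structure.RelMap R (fun i => (⟨x i, hb' n x i⟩ : (M (b n x)).carrier)) }
  let U : SetModel L := ⟨C, inferInstance, str⟩
  refine ⟨U, fun α hα => ?_, hC⟩
  have hs : (M α).carrier ⊆ U.carrier := fun x hx => (hC x).2 ⟨α, hα, hx⟩
  refine IsSub.of_inclusion hs (fun n F x => ?_) fun n R x => ?_
  · rcases le_total α (b n (Set.inclusion hs ∘ x)) with h | h
    · exact (hM _ _ h (hb n _)).funMap_eq F fun i => rfl
    · exact ((hM _ _ h hα).funMap_eq F fun i => rfl).symm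
  · rcases le_total α (b n (Set.inclusion hs ∘ x)) with h | h
    · exact ((hM _ _ h (hb n _)).relMap_iff R fun i => rfl).symm
    · exact (hM _ _ h hα).relMap_iff R fun i => rfl

theorem lift_card (M : SetModel L) : Cardinal.lift.{u + 1} M.card = #M.carrier := by
  rw [card, Cardinal.lift_mk_shrink'']

theorem card_le_of_subset (h : M.carrier ⊆ N.carrier) : M.card ≤ N.card := by
  rw [← Cardinal.lift_le.{u + 1}, lift_card, lift_card]
  exact Cardinal.mk_le_mk_of_subset h

theorem mk_Iio_le {δ : Ordinal.{u}} {μ : Cardinal.{u}} (hδ : δ.card ≤ μ) :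
    #(Set.Iio δ) ≤ Cardinal.lift.{u + 1} μ := by
  rw [Cardinal.mk_Iio_ordinal]
  exact Cardinal.lift_le.2 hδ

theorem IsUnion.card_le {Ms : Ordinal.{u} → SetModel L} {δ : Ordinal.{u}} {μ : Cardinal.{u}}
    (hU : IsUnion Ms δ N) (hμ : ℵ₀ ≤ μ) (hδ : δ.card ≤ μ) (hM : ∀ α < δ, (Ms α).card ≤ μ) :
    N.card ≤ μ := by
  rw [← Cardinal.lift_le.{u + 1}, lift_card]
  have : N.carrier ⊆ ⋃ α : Set.Iio δ, (Ms α).carrier := by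
    intro x hx
    obtain ⟨α, hα, hx⟩ := (hU.2 x).1 hx
    exact Set.mem_iUnion.2 ⟨⟨α, hα⟩, hx⟩
  refine (Cardinal.mk_le_mk_of_subset this).trans ((Cardinal.mk_iUnion_le _).trans ?_)
  refine (mul_le_mul' (mk_Iio_le hδ) (ciSup_le' fun α => ?_)).trans
    (Cardinal.mul_eq_self (Cardinal.aleph0_le_lift.2 hμ)).le
  rw [← lift_card]
  exact Cardinal.lift_le.2 (hM α α.2)

theorem IsUnion.congr {Ms Ns : Ordinal.{u} → SetModel L} {δ : Ordinal.{u}}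
    (hU : IsUnion Ms δ N) (h : ∀ α < δ, Ms α = Ns α) : IsUnion Ns δ N := by
  refine ⟨fun α hα => h α hα ▸ hU.1 α hα, fun x => (hU.2 x).trans ?_⟩
  constructor <;> rintro ⟨α, hα, hx⟩
  · exact ⟨α, hα, h α hα ▸ hx⟩
  · exact ⟨α, hα, h α hα ▸ hx⟩

/-- An embedding of `M` into `N` becomes an inclusion after replacing `N` by an isomorphic copy. -/
theorem exists_extend_iso (h : IsIso f M P) :
    ∃ g N', IsIso g N N' ∧ ∀ x ∈ M.carrier, g (f x) = x := by
  classical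
  obtain ⟨g, hg, hgf, hfg⟩ := h.symm
  let m : ZFSet.{u} := ZFSet.range (fun x : Shrink.{u} M.carrier =>
    (((equivShrink M.carrier).symm x : M.carrier) : ZFSet.{u}))
  have hm : ∀ x ∈ M.carrier, x ∈ m := fun x hx =>
    ZFSet.mem_range.2 ⟨equivShrink _ ⟨x, hx⟩, by simp⟩
  -- As `m` contains all elements of `M`, no pair with first component `m` is an element of `M`.
  have hfresh : ∀ y, ZFSet.pair m y ∉ M.carrier := by
    intro y hy
    have h1 := ZFSet.rank_lt_of_mem (hm _ hy)
    have h2 : ({m} : ZFSet) ∈ ZFSet.pair m y := by simp [ZFSet.pair]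
    have h3 : m ∈ ({m} : ZFSet) := by simp
    exact absurd (((ZFSet.rank_lt_of_mem h3).trans (ZFSet.rank_lt_of_mem h2)).trans h1)
      (lt_irrefl _)
  let k : ZFSet → ZFSet := fun y => if y ∈ P.carrier then g y else ZFSet.pair m y
  have hk : Set.InjOn k N.carrier := by
    intro x _ y _ hxy
    simp only [k] at hxy
    split_ifs at hxy with h1 h2 h2
    · exact hg.injOn h1 h2 hxy
    · exact absurd (hxy ▸ hg.mem h1) (hfresh y)
    · exact absurd (hxy ▸ hg.mem h2) (hfresh x)
    · exact (ZFSet.pair_inj.1 hxy).2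
  obtain ⟨N', hN'⟩ := exists_isIso N hk
  exact ⟨k, N', hN', fun x hx => by simp [k, h.mem hx, hgf x hx]⟩

theorem IsIso.symm_of_leftInv (h : IsIso f M N) (hg : ∀ x ∈ M.carrier, g (f x) = x) :
    IsIso g N M := by
  obtain ⟨k, hk, hkf, -⟩ := h.symm
  refine hk.congr fun y hy => ?_
  obtain ⟨x, hx, rfl⟩ := h.exists_of_mem hy
  rw [hkf x hx, hg x hx]

theorem IsUnion.iso {Ms Ps : Ordinal.{u} → SetModel L} {δ : Ordinal.{u}} (h : IsUnion Ms δ M)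
    (hf : IsIso f M P) (hfs : ∀ α < δ, IsIso f (Ms α) (Ps α)) : IsUnion Ps δ P := by
  refine ⟨fun α hα => hf.isSub (hfs α hα) (h.1 α hα), fun y => ⟨fun hy => ?_, ?_⟩⟩
  · obtain ⟨x, hx, rfl⟩ := hf.exists_of_mem hy
    obtain ⟨α, hα, hx⟩ := (h.2 x).1 hx
    exact ⟨α, hα, (hfs α hα).mem hx⟩
  · rintro ⟨α, hα, hy⟩
    obtain ⟨x, hx, rfl⟩ := (hfs α hα).exists_of_mem hy
    exact hf.mem ((h.2 x).2 ⟨α, hα, hx⟩)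

/-- The elements of `M` can be enumerated along the initial ordinal of its cardinality. -/
theorem exists_enum {μ : Cardinal.{u}} (hM : M.card = μ) :
    ∃ e : Ordinal.{u} → ZFSet.{u}, (∀ x ∈ M.carrier, ∃ α < μ.ord, e α = x) ∧
      ∀ α < μ.ord, e α ∈ M.carrier := by
  classical
  have : #(Set.Iio μ.ord) = #M.carrier := by
    rw [Cardinal.mk_Iio_ordinal, Cardinal.card_ord, ← lift_card, hM]
  obtain ⟨e⟩ := Cardinal.eq.1 this
  refine ⟨fun α => if h : α < μ.ord then e ⟨α, h⟩ else ∅, fun x hx => ?_, fun α hα => ?_⟩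
  · refine ⟨e.symm ⟨x, hx⟩, (e.symm ⟨x, hx⟩).2, ?_⟩
    have h : ((e.symm ⟨x, hx⟩ : Set.Iio μ.ord) : Ordinal.{u}) < μ.ord := (e.symm ⟨x, hx⟩).2
    simp only [h, dif_pos]
    exact congrArg Subtype.val (e.apply_symm_apply ⟨x, hx⟩)
  · simp only [hα, dif_pos]
    exact (e _).2

end SetModel

open SetModel

/-! ### Transfinite sequences -/

/-- Transfinite dependent choice: a sequence whose terms satisfy a condition `Q` relative to the
earlier terms exists as soon as each partial sequence can be prolonged. -/
theorem exists_transfinite_seq {S : Type*} [Nonempty S] (θ : Ordinal.{u})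
    (Q : Ordinal.{u} → (Ordinal.{u} → S) → S → Prop)
    (hloc : ∀ α F G s, (∀ β < α, F β = G β) → Q α F s → Q α G s)
    (hstep : ∀ α < θ, ∀ F, (∀ β < α, Q β F (F β)) → ∃ s, Q α F s) :
    ∃ F : Ordinal.{u} → S, ∀ α < θ, Q α F (F α) := by
  classical
  let cut : (α : Ordinal.{u}) → ((β : Ordinal.{u}) → β < α → S) → Ordinal.{u} → S :=
    fun α ih β => if h : β < α then ih β h else Classical.arbitrary S
  let F : Ordinal.{u} → S := WellFounded.fix (wellFounded_lt (α := Ordinal.{u}))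
    fun α ih => Classical.epsilon fun s => Q α (cut α ih) s
  have hF : ∀ α, F α = Classical.epsilon fun s => Q α (cut α fun β _ => F β) s :=
    fun α => WellFounded.fix_eq _ _ α
  have hcut : ∀ α, ∀ β < α, F β = cut α (fun β _ => F β) β := fun α β h => by simp [cut, h]
  refine ⟨F, fun α => ?_⟩
  induction α using WellFoundedLT.induction with
  | _ α ih =>
    intro hα
    obtain ⟨s, hs⟩ := hstep α hα F fun β hβ => ih β hβ (hβ.trans hα)
    have := Classical.epsilon_spec ⟨s, hloc _ _ _ s (hcut α) hs⟩
    rw [← hF] at this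
    exact hloc _ _ _ _ (fun β hβ => (hcut α β hβ).symm) this

theorem ordinal_add_one_ne_zero (α : Ordinal.{u}) : α + 1 ≠ 0 := by
  rw [← Order.succ_eq_add_one]
  exact Order.succ_ne_bot α

theorem not_isSuccLimit_add_one (α : Ordinal.{u}) : ¬ Order.IsSuccLimit (α + 1) := by
  rw [← Order.succ_eq_add_one]
  exact Order.not_isSuccLimit_succ α

theorem card_le_of_lt_succ_ord {lam : Cardinal.{u}} {α : Ordinal.{u}}
    (h : α < (Order.succ lam).ord) : α.card ≤ lam :=
  Order.lt_succ_iff.1 (Cardinal.lt_ord.1 h)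

namespace AbstractClass

/-! ### Embeddings and amalgamation -/

variable {L : FirstOrder.Language.{u, u}} {K : AbstractClass L}
  {M N P M' N' M₀ M₁ M₂ : SetModel L} {f g : ZFSet.{u} → ZFSet.{u}} {lam μ : Cardinal.{u}}

theorem subset_of_le (h : K.le M N) : M.carrier ⊆ N.carrier := (K.le_sub h).subset

theorem Coherent.le_of_subset (hK : K.Coherent) (hM : K.le M P) (hN : K.le N P)
    (h : M.carrier ⊆ N.carrier) : K.le M N :=
  hK _ _ _ hM hN ((K.le_sub hM).of_subset (K.le_sub hN) h)

theorem exists_le_of_isIso (h : K.le M N) (hf : IsIso f N N') :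
    ∃ M', IsIso f M M' ∧ K.le M' N' := by
  obtain ⟨M', hM'⟩ := hf.exists_isIso_of_isSub (K.le_sub h)
  exact ⟨M', hM', K.le_iso h hf hM'⟩

theorem MemCard.iso (h : K.MemCard μ M) (hf : IsIso f M N) : K.MemCard μ N :=
  (K.atCard μ).mem_iso hf h

theorem IsEmb.of_le (h : K.le M N) : K.IsEmb id M N := ⟨M, IsIso.refl M, h⟩

theorem IsEmb.le_target (h : K.IsEmb f M N) (hN : K.le N P) : K.IsEmb f M P := by
  obtain ⟨M', hM', h'⟩ := h
  exact ⟨M', hM', K.le_trans h' hN⟩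

theorem IsEmb.le_source (h : K.IsEmb f M N) (hM : K.le M' M) : K.IsEmb f M' N := by
  obtain ⟨M₁, hM₁, h'⟩ := h
  obtain ⟨M₂, hM₂, h₂⟩ := exists_le_of_isIso hM hM₁
  exact ⟨M₂, hM₂, K.le_trans h₂ h'⟩

theorem IsEmb.comp_iso (h : K.IsEmb f M N) (hg : IsIso g N P) : K.IsEmb (g ∘ f) M P := by
  obtain ⟨M', hM', h'⟩ := h
  obtain ⟨P', hP', h₂⟩ := exists_le_of_isIso h' hg
  exact ⟨P', hM'.trans hP', h₂⟩

theorem IsEmb.comp (h : K.IsEmb f M N) (hg : K.IsEmb g N P) : K.IsEmb (g ∘ f) M P := by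
  obtain ⟨N', hN', h'⟩ := hg
  exact (h.comp_iso hN').le_target h'

/-- The target of an embedding of `M` can be replaced by an isomorphic copy that extends `M`. -/
theorem IsEmb.exists_extend (h : K.IsEmb f M N) :
    ∃ g N', IsIso g N N' ∧ K.le M N' ∧ ∀ x ∈ M.carrier, g (f x) = x := by
  obtain ⟨P, hP, h'⟩ := h
  obtain ⟨g, N', hg, hgf⟩ := exists_extend_iso hP (N := N)
  obtain ⟨k, hk, hkf, -⟩ := hP.symm
  refine ⟨g, N', hg, K.le_iso h' hg (hk.congr fun y hy => ?_), hgf⟩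
  obtain ⟨x, hx, rfl⟩ := hP.exists_of_mem hy
  rw [hkf x hx, hgf x hx]

/-- An isomorphism of `M` onto `P` extends to an isomorphism of a model `N` above `M` onto a model
above `P`. -/
theorem exists_iso_extending (hf : IsIso f M P) (h : K.le M N) :
    ∃ g N', IsIso g N N' ∧ K.le P N' ∧ ∀ x ∈ M.carrier, g x = f x := by
  obtain ⟨k, hk, hkf, hfk⟩ := hf.symm
  obtain ⟨g, N', hg, h', hgk⟩ := IsEmb.exists_extend (K := K) ⟨M, hk, h⟩
  refine ⟨g, N', hg, h', fun x hx => ?_⟩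
  have := hgk (f x) (hf.mem hx)
  rwa [hkf x hx] at this

/-- In an amalgam one of the two embeddings may be taken to be an inclusion. -/
theorem Amalgamation.exists_le (hA : K.Amalgamation μ) (h₀ : K.MemCard μ M₀)
    (h₁ : K.MemCard μ M₁) (h₂ : K.MemCard μ M₂) (h₀₁ : K.le M₀ M₁) (h₀₂ : K.le M₀ M₂) :
    ∃ M₃ g, K.MemCard μ M₃ ∧ K.le M₂ M₃ ∧ K.IsEmbOver M₀ g M₁ M₃ := by
  obtain ⟨M₃, f₁, f₂, hM₃, hf₁, hf₂⟩ := hA _ _ _ h₀ h₁ h₂ h₀₁ h₀₂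
  obtain ⟨g, N, hg, hN, hgf⟩ := hf₂.1.exists_extend
  refine ⟨N, g ∘ f₁, hM₃.iso hg, hN, hf₁.1.comp_iso hg, fun x hx => ?_⟩
  have := hgf x (subset_of_le h₀₂ hx)
  rw [hf₂.2 x hx] at this
  simp [hf₁.2 x hx, this]

/-! ### Löwenheim–Skolem submodels and chains of submodels -/

/-- The Löwenheim–Skolem property yields submodels of each exact cardinality `μ` between `lam` and
`‖N‖`. -/
theorem HasLST.exists_le (hL : K.HasLST lam) (h0 : ℵ₀ ≤ lam) (hμ : lam ≤ μ) (hN : K.Mem N)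
    (hμN : μ ≤ N.card) {A : Set ZFSet.{u}} (hA : A ⊆ N.carrier)
    (hAc : #A ≤ Cardinal.lift.{u + 1} μ) :
    ∃ M, K.MemCard μ M ∧ K.le M N ∧ A ⊆ M.carrier := by
  -- Padding `A` with a set `B` of size `μ` forces the submodel to have cardinality at least `μ`.
  obtain ⟨B, hB, hBc⟩ := Cardinal.le_mk_iff_exists_subset.1
    ((Cardinal.lift_le.{u + 1}.2 hμN).trans (lift_card N).le)
  obtain ⟨M, hM, hAM, hMc⟩ := hL N (A ∪ B) hN (Set.union_subset hA hB)
  have hi : ℵ₀ ≤ Cardinal.lift.{u + 1} μ := Cardinal.aleph0_le_lift.2 (h0.trans hμ)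
  refine ⟨M, ⟨(K.mem_of_le hM).1, le_antisymm ?_ ?_⟩, hM, Set.subset_union_left.trans hAM⟩
  · rw [← Cardinal.lift_le.{u + 1}]
    refine hMc.trans ?_
    refine Cardinal.add_le_of_le hi (Cardinal.lift_le.2 hμ) ?_
    exact (Cardinal.mk_union_le A B).trans (Cardinal.add_le_of_le hi hAc hBc.le)
  · rw [← Cardinal.lift_le.{u + 1}, ← hBc, lift_card]
    exact Cardinal.mk_le_mk_of_subset (Set.subset_union_right.trans hAM)

theorem mk_carrier_le (h : K.MemCard lam M) (hμ : lam ≤ μ) :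
    #M.carrier ≤ Cardinal.lift.{u + 1} μ := by
  rw [← lift_card, h.2]
  exact Cardinal.lift_le.2 hμ

theorem HasLST.exists_between (hL : K.HasLST lam) (hK : K.IsAEC) (h0 : ℵ₀ ≤ lam) (hμ : lam ≤ μ)
    (hμN : μ ≤ N.card) (hMN : K.le M N) (hM : M.card ≤ μ) {A : Set ZFSet.{u}}
    (hA : A ⊆ N.carrier) (hAc : #A ≤ Cardinal.lift.{u + 1} μ) :
    ∃ P, K.MemCard μ P ∧ K.le M P ∧ K.le P N ∧ A ⊆ P.carrier := by
  obtain ⟨P, hP, hPN, hAP⟩ := hL.exists_le h0 hμ (K.mem_of_le hMN).2 hμN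
    (Set.union_subset (subset_of_le hMN) hA) ((Cardinal.mk_union_le _ _).trans
      (Cardinal.add_le_of_le (Cardinal.aleph0_le_lift.2 (h0.trans hμ))
        ((lift_card M).symm.le.trans (Cardinal.lift_le.2 hM)) hAc))
  exact ⟨P, hP, hK.coherent.le_of_subset hMN hPN (Set.subset_union_left.trans hAP), hPN,
    Set.subset_union_right.trans hAP⟩

theorem IsIncCont.mono {δ θ : Ordinal.{u}} {Ms : Ordinal.{u} → SetModel L} (h : K.IsIncCont θ Ms)
    (hδ : δ ≤ θ) : K.IsIncCont δ Ms :=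
  ⟨fun α β hαβ hβ => h.1 α β hαβ (hβ.trans_le hδ), fun γ hγ => h.2 γ (hγ.trans_le hδ)⟩

theorem IsIncCont.succ {δ : Ordinal.{u}} {Ms : Ordinal.{u} → SetModel L} (h : K.IsIncCont δ Ms)
    (hδ : K.Mem (Ms δ)) (hle : ∀ α < δ, K.le (Ms α) (Ms δ))
    (hu : Order.IsSuccLimit δ → IsUnion Ms δ (Ms δ)) : K.IsIncCont (δ + 1) Ms := by
  refine ⟨fun α β hαβ hβ => ?_, fun γ hγ hl => ?_⟩
  · rcases (Order.lt_add_one_iff.1 hβ).eq_or_lt with rfl | hβ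
    · rcases hαβ.eq_or_lt with rfl | hαβ
      · exact K.le_refl hδ
      · exact hle _ hαβ
    · exact h.1 _ _ hαβ hβ
  · rcases (Order.lt_add_one_iff.1 hγ).eq_or_lt with rfl | hγ
    · exact hu hl
    · exact h.2 γ hγ hl

theorem IsIncCont.congr {δ : Ordinal.{u}} {Ms Ns : Ordinal.{u} → SetModel L}
    (h : K.IsIncCont δ Ms) (he : ∀ α < δ, Ms α = Ns α) : K.IsIncCont δ Ns := by
  refine ⟨fun α β hαβ hβ => he _ hβ ▸ he _ (hαβ.trans_lt hβ) ▸ h.1 α β hαβ hβ, fun γ hγ hl => ?_⟩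
  rw [← he γ hγ]
  exact (h.2 γ hγ hl).congr fun α hα => he α (hα.trans hγ)

theorem IsAEC.exists_isUnion (hK : K.IsAEC) {δ : Ordinal.{u}} {Ms : Ordinal.{u} → SetModel L}
    (hδ : Order.IsSuccLimit δ) (hM : K.IsIncCont δ Ms) :
    ∃ U, IsUnion Ms δ U ∧ K.Mem U ∧ ∀ α < δ, K.le (Ms α) U := by
  obtain ⟨U, hU⟩ := SetModel.exists_isUnion (M := Ms) ((pos_iff_ne_zero.2 hδ.ne_bot))
    fun α β hαβ hβ => K.le_sub (hM.1 α β hαβ hβ)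
  exact ⟨U, hU, hK.union δ Ms U trivial hδ hM hU⟩

theorem card_eq_of_isUnion {δ : Ordinal.{u}} {Ms : Ordinal.{u} → SetModel L}
    (hδ : Order.IsSuccLimit δ) (hμ : ℵ₀ ≤ μ) (hδc : δ.card ≤ μ) (hM : ∀ α < δ, (Ms α).card = μ)
    (hU : IsUnion Ms δ N) : N.card = μ := by
  refine le_antisymm (hU.card_le hμ hδc fun α hα => (hM α hα).le) ?_
  have h0 : 0 < δ := pos_iff_ne_zero.2 hδ.ne_bot
  exact (hM 0 h0).ge.trans (card_le_of_subset (hU.1 0 h0).subset)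

/-- A chain of models of cardinality `lam`, starting at `B`, whose `α`-th member lies in `T α`
and whose successor members contain prescribed small sets. -/
theorem HasLST.exists_chain (hL : K.HasLST lam) (hK : K.IsAEC) (h0 : ℵ₀ ≤ lam)
    {θ : Ordinal.{u}} (hθ : θ ≤ (Order.succ lam).ord) (T : Ordinal.{u} → SetModel L)
    (hT : ∀ α β, α ≤ β → β < θ → K.le (T α) (T β))
    (Φ : Ordinal.{u} → SetModel L → Set ZFSet.{u})
    (hΦ : ∀ α A, α + 1 < θ → K.MemCard lam A → K.le A (T α) →
      Φ α A ⊆ (T (α + 1)).carrier ∧ #(Φ α A) ≤ Cardinal.lift.{u + 1} lam)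
    {B : SetModel L} (hB : K.MemCard lam B) (hBT : K.le B (T 0)) :
    ∃ A : Ordinal.{u} → SetModel L, A 0 = B ∧ K.IsIncCont θ A ∧
      (∀ α < θ, K.MemCard lam (A α) ∧ K.le (A α) (T α)) ∧
      ∀ α, α + 1 < θ → Φ α (A α) ⊆ (A (α + 1)).carrier := by
  have : Nonempty (SetModel L) := ⟨B⟩
  obtain ⟨A, hA⟩ := exists_transfinite_seq θ
    (fun α (F : Ordinal.{u} → SetModel L) s => (α = 0 → s = B) ∧ K.MemCard lam s ∧
      K.le s (T α) ∧ (∀ β < α, K.le (F β) s) ∧ (∀ β, α = β + 1 → Φ β (F β) ⊆ s.carrier) ∧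
      (Order.IsSuccLimit α → IsUnion F α s))
    (by
      rintro α F G s h ⟨h1, h2, h3, h4, h5, h6⟩
      refine ⟨h1, h2, h3, fun β hβ => h β hβ ▸ h4 β hβ, fun β hβ => ?_, fun hl => (h6 hl).congr h⟩
      rw [← h β (by rw [hβ]; exact Order.lt_add_one_iff.2 le_rfl)]
      exact h5 β hβ)
    (by
      intro α hα F hF
      rcases Ordinal.zero_or_succ_or_isSuccLimit α with rfl | ⟨β, rfl⟩ | hl
      · refine ⟨B, fun _ => rfl, hB, hBT, fun β hβ => absurd hβ not_lt_zero, fun β hβ => ?_,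
          fun hl => absurd rfl hl.ne_bot⟩
        exact absurd hβ.symm (ordinal_add_one_ne_zero β)
      · rw [Order.succ_eq_add_one] at hα hF ⊢
        have hβ : β < β + 1 := Order.lt_add_one_iff.2 le_rfl
        obtain ⟨-, h2, h3, h4, -, -⟩ := hF β hβ
        have hT' := K.le_trans h3 (hT _ _ hβ.le hα)
        obtain ⟨h5, h6⟩ := hΦ β (F β) hα h2 h3
        obtain ⟨P, hP, hFP, hPT, hΦP⟩ := hL.exists_between hK h0 le_rfl
          (h2.2.ge.trans (card_le_of_subset (subset_of_le hT'))) hT' h2.2.le h5 h6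
        refine ⟨P, fun h => absurd h (ordinal_add_one_ne_zero β), hP, hPT,
          fun γ hγ => ?_, fun γ hγ => ?_, fun hl => absurd hl (not_isSuccLimit_add_one β)⟩
        · rcases (Order.lt_add_one_iff.1 hγ).eq_or_lt with rfl | hγ
          · exact hFP
          · exact K.le_trans (h4 γ hγ) hFP
        · obtain rfl : β = γ := by simpa using hγ
          exact hΦP
      · have hinc : K.IsIncCont α F := by
          refine ⟨fun β γ hβγ hγ => ?_, fun γ hγ hl => (hF γ hγ).2.2.2.2.2 hl⟩
          rcases hβγ.eq_or_lt with rfl | hβγ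
          · exact K.le_refl (hF _ hγ).2.1.1
          · exact (hF γ hγ).2.2.2.1 β hβγ
        obtain ⟨U, hU, hUm, hUle⟩ := hK.exists_isUnion hl hinc
        refine ⟨U, fun h => absurd h hl.ne_bot, ⟨hUm, card_eq_of_isUnion hl h0
          (card_le_of_lt_succ_ord (hα.trans_le hθ)) (fun β hβ => (hF β hβ).2.1.2) hU⟩,
          hK.smooth α F U _ trivial hl hinc hU fun β hβ =>
            K.le_trans (hF β hβ).2.2.1 (hT _ _ hβ.le hα), hUle, fun β hβ => ?_, fun _ => hU⟩
        exact absurd (hβ ▸ hl) (not_isSuccLimit_add_one β))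
  by_cases hθ0 : θ = 0
  · subst hθ0
    exact ⟨fun _ => B, rfl, ⟨fun _ _ _ h => absurd h not_lt_zero, fun _ h => absurd h not_lt_zero⟩,
      fun _ h => absurd h not_lt_zero, fun _ h => absurd h not_lt_zero⟩
  refine ⟨A, (hA 0 (pos_iff_ne_zero.2 hθ0)).1 rfl, ⟨fun β γ hβγ hγ => ?_,
    fun γ hγ hl => (hA γ hγ).2.2.2.2.2 hl⟩, fun α hα => ⟨(hA α hα).2.1, (hA α hα).2.2.1⟩,
    fun α hα => (hA _ hα).2.2.2.2.1 α rfl⟩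
  rcases hβγ.eq_or_lt with rfl | hβγ
  · exact K.le_refl (hA _ hγ).2.1.1
  · exact (hA γ hγ).2.2.2.1 β hβγ

end AbstractClass

namespace AbstractClass

/-! ### Galois types -/

variable {L : FirstOrder.Language.{u, u}} {K : AbstractClass L}
  {M N P M' N' M₀ M₁ M₂ M₃ N₁ N₂ : SetModel L} {f g f₁ f₂ : ZFSet.{u} → ZFSet.{u}}
  {lam μ : Cardinal.{u}} {a b : ZFSet.{u}}

theorem IsEmbOver.of_le (h : K.le M N) : K.IsEmbOver P id M N := ⟨IsEmb.of_le h, fun _ _ => rfl⟩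

/-- A common target of two embeddings can be chosen to extend the second source. -/
theorem IsEmbOver.exists_extend (h₁ : K.IsEmbOver M f₁ N₁ M₃) (h₂ : K.IsEmbOver M f₂ N₂ M₃)
    (hM : K.le M N₂) : ∃ P k, IsIso k M₃ P ∧ K.le N₂ P ∧ K.IsEmbOver M (k ∘ f₁) N₁ P ∧
      ∀ x ∈ N₂.carrier, k (f₂ x) = x := by
  obtain ⟨k, P, hk, hP, hkf⟩ := h₂.1.exists_extend
  refine ⟨P, k, hk, hP, ⟨h₁.1.comp_iso hk, fun x hx => ?_⟩, hkf⟩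
  have := hkf x (subset_of_le hM hx)
  rw [h₂.2 x hx] at this
  simp [h₁.2 x hx, this]

theorem tp_eq_of_isEmbOver (hg : K.IsEmbOver M g N N') (h : K.le M N) (h' : K.le M N')
    (ha : a ∈ N.carrier) (ha' : a ∉ M.carrier) (hb : b ∈ N'.carrier) (hb' : b ∉ M.carrier)
    (hab : g a = b) : tp h ha ha' = tp h' hb hb' :=
  Quot.sound ⟨N', g, id, hg, IsEmbOver.of_le (K.le_refl (K.mem_of_le h').2), hab⟩

theorem tp_eq_of_le (h : K.le M N) (h' : K.le M N') (hN : K.le N N') (ha : a ∈ N.carrier)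
    (ha' : a ∉ M.carrier) (hb : a ∈ N'.carrier) : tp h ha ha' = tp h' hb ha' :=
  tp_eq_of_isEmbOver (IsEmbOver.of_le hN) h h' ha ha' hb ha' rfl

theorem GType.restrict_refl (h : K.le M M) (p : K.GType M) : p.restrict h = p := by
  induction p using Quot.ind
  rfl

/-- A common target of two embeddings of models of cardinality `μ` can be cut down to
cardinality `μ`. -/
theorem isEmb_exists_between (hL : K.HasLST lam) (hK : K.IsAEC) (h0 : ℵ₀ ≤ lam) (hμ : lam ≤ μ)
    (hN₁ : K.MemCard μ N₁) (hN₂ : K.MemCard μ N₂) (h₁ : K.IsEmb f₁ N₁ M₃)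
    (h₂ : K.IsEmb f₂ N₂ M₃) : ∃ P, K.MemCard μ P ∧ K.le P M₃ ∧ K.IsEmb f₁ N₁ P ∧
      K.IsEmb f₂ N₂ P := by
  obtain ⟨P₁, hP₁, hle₁⟩ := h₁
  obtain ⟨P₂, hP₂, hle₂⟩ := h₂
  obtain ⟨P, hP, hP₁P, hPM, hP₂P⟩ := hL.exists_between hK h0 hμ
    ((hN₁.iso hP₁).2.ge.trans (card_le_of_subset (subset_of_le hle₁))) hle₁ (hN₁.iso hP₁).2.le
    (subset_of_le hle₂) (mk_carrier_le (hN₂.iso hP₂) le_rfl)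
  exact ⟨P, hP, hPM, ⟨P₁, hP₁, hP₁P⟩, ⟨P₂, hP₂, hK.coherent.le_of_subset hle₂ hPM hP₂P⟩⟩

/-- Under amalgamation in `lam`, the relation `E*` is transitive on triples of models of
cardinality `lam`. Intermediate triples of larger cardinality are replaced by small submodels. -/
theorem exists_amalgam_of_mk_eq (hA : K.Amalgamation lam) (hL : K.HasLST lam) (hK : K.IsAEC)
    (h0 : ℵ₀ ≤ lam) (hM : K.MemCard lam M) {t₁ t₂ : K.Triple M}
    (h : Quot.mk Triple.EStar t₁ = Quot.mk Triple.EStar t₂)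
    (h₁ : K.MemCard lam t₁.top) (h₂ : K.MemCard lam t₂.top) :
    ∃ P g, K.MemCard lam P ∧ K.le t₂.top P ∧ K.IsEmbOver M g t₁.top P ∧ g t₁.elt = t₂.elt := by
  -- The induction along the generated equivalence is on triples with tops of any cardinality,
  -- quantifying over their small submodels.
  suffices H : ∀ N₁ N₂, K.MemCard lam N₁ → K.MemCard lam N₂ → K.le M N₁ → K.le M N₂ →
      K.le N₁ t₁.top → K.le N₂ t₂.top → t₁.elt ∈ N₁.carrier → t₂.elt ∈ N₂.carrier →
      ∃ M₃ f₁ f₂, K.MemCard lam M₃ ∧ K.IsEmbOver M f₁ N₁ M₃ ∧ K.IsEmbOver M f₂ N₂ M₃ ∧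
        f₁ t₁.elt = f₂ t₂.elt by
    obtain ⟨M₃, f₁, f₂, hM₃, hf₁, hf₂, he⟩ := H _ _ h₁ h₂ t₁.le_top t₂.le_top
      (K.le_refl h₁.1) (K.le_refl h₂.1) t₁.elt_mem t₂.elt_mem
    obtain ⟨P, k, hk, hP, hkf, hk'⟩ := hf₁.exists_extend hf₂ t₂.le_top
    exact ⟨P, k ∘ f₁, hM₃.iso hk, hP, hkf, by simp [he, hk' _ t₂.elt_mem]⟩
  replace h := Quot.eqvGen_exact h
  clear h₁ h₂
  induction h with
  | rel t₁ t₂ h =>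
    intro N₁ N₂ hN₁ hN₂ hM₁ hM₂ hle₁ hle₂ ha₁ ha₂
    obtain ⟨M₃, f₁, f₂, hf₁, hf₂, he⟩ := h
    obtain ⟨P, hP, -, hP₁, hP₂⟩ := isEmb_exists_between hL hK h0 le_rfl hN₁ hN₂
      (hf₁.1.le_source hle₁) (hf₂.1.le_source hle₂)
    exact ⟨P, f₁, f₂, hP, ⟨hP₁, hf₁.2⟩, ⟨hP₂, hf₂.2⟩, he⟩
  | refl t =>
    intro N₁ N₂ hN₁ hN₂ hM₁ hM₂ hle₁ hle₂ ha₁ ha₂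
    obtain ⟨P, hP, -, hP₁, hP₂⟩ := isEmb_exists_between hL hK h0 le_rfl hN₁ hN₂
      (IsEmb.of_le hle₁) (IsEmb.of_le hle₂)
    exact ⟨P, id, id, hP, ⟨hP₁, fun _ _ => rfl⟩, ⟨hP₂, fun _ _ => rfl⟩, rfl⟩
  | symm t₁ t₂ _ ih =>
    intro N₁ N₂ hN₁ hN₂ hM₁ hM₂ hle₁ hle₂ ha₁ ha₂
    obtain ⟨M₃, f₁, f₂, hM₃, hf₁, hf₂, he⟩ := ih N₂ N₁ hN₂ hN₁ hM₂ hM₁ hle₂ hle₁ ha₂ ha₁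
    exact ⟨M₃, f₂, f₁, hM₃, hf₂, hf₁, he.symm⟩
  | trans t₁ t t₂ _ _ ih₁ ih₂ =>
    intro N₁ N₂ hN₁ hN₂ hM₁ hM₂ hle₁ hle₂ ha₁ ha₂
    obtain ⟨N, hN, hMN, hNt, hN'⟩ := hL.exists_between hK h0 le_rfl
      (hM.2.ge.trans (card_le_of_subset (subset_of_le t.le_top))) t.le_top hM.2.le
      (A := {t.elt}) (by simpa using t.elt_mem) (by
        rw [Cardinal.mk_singleton]
        exact Cardinal.one_le_aleph0.trans (Cardinal.aleph0_le_lift.2 h0))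
    have ha : t.elt ∈ N.carrier := hN' rfl
    obtain ⟨P₁, f₁, f, hP₁, hf₁, hf, he₁⟩ := ih₁ N₁ N hN₁ hN hM₁ hMN hle₁ hNt ha₁ ha
    obtain ⟨P₂, g, f₂, hP₂, hg, hf₂, he₂⟩ := ih₂ N N₂ hN hN₂ hMN hM₂ hNt hle₂ ha ha₂
    obtain ⟨Q₁, k, hk, hQ₁, hk₁, hkf⟩ := hf₁.exists_extend hf hMN
    obtain ⟨Q₂, l, hl, hQ₂, hl₂, hlg⟩ := hf₂.exists_extend hg hMN
    obtain ⟨Q, r, hQ, hle, hr⟩ := hA.exists_le hN (hP₁.iso hk) (hP₂.iso hl) hQ₁ hQ₂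
    refine ⟨Q, r ∘ k ∘ f₁, l ∘ f₂, hQ, ⟨hk₁.1.comp hr.1, fun x hx => ?_⟩,
      ⟨hl₂.1.le_target hle, hl₂.2⟩, ?_⟩
    · rw [Function.comp_apply, hk₁.2 x hx, hr.2 x (subset_of_le hMN hx)]
    · simp [he₁, hkf _ ha, hr.2 _ ha, ← he₂, hlg _ ha]

/-- Equality of types of triples in `K_μ` does not depend on whether `E*` is computed in `K` or
in `K_μ`. -/
theorem GType.ofAtCard_injective (hL : K.HasLST lam) (hK : K.IsAEC) (h0 : ℵ₀ ≤ lam)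
    (hμ : lam ≤ μ) : Function.Injective (GType.ofAtCard (K := K) (μ := μ) (M := M)) := by
  intro p q hpq
  induction p using Quot.ind with | _ s₁
  induction q using Quot.ind with | _ s₂
  have hM : K.MemCard μ M := ((K.atCard μ).mem_of_le s₁.le_top).1
  suffices H : ∀ t₁ t₂ : K.Triple M, Relation.EqvGen Triple.EStar t₁ t₂ →
      ∀ N₁ N₂ (h₁ : (K.atCard μ).le M N₁) (h₂ : (K.atCard μ).le M N₂)
        (ha₁ : t₁.elt ∈ N₁.carrier) (ha₂ : t₂.elt ∈ N₂.carrier), K.le N₁ t₁.top → K.le N₂ t₂.top →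
      tp h₁ ha₁ t₁.elt_notMem = tp h₂ ha₂ t₂.elt_notMem from
    H _ _ (Quot.eqvGen_exact hpq) s₁.top s₂.top s₁.le_top s₂.le_top s₁.elt_mem s₂.elt_mem
      (K.le_refl (K.mem_of_le s₁.le_top.1).2) (K.le_refl (K.mem_of_le s₂.le_top.1).2)
  have hrel : ∀ t₁ t₂ : K.Triple M, Triple.EStar t₁ t₂ →
      ∀ N₁ N₂ (h₁ : (K.atCard μ).le M N₁) (h₂ : (K.atCard μ).le M N₂)
        (ha₁ : t₁.elt ∈ N₁.carrier) (ha₂ : t₂.elt ∈ N₂.carrier), K.le N₁ t₁.top → K.le N₂ t₂.top →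
      tp h₁ ha₁ t₁.elt_notMem = tp h₂ ha₂ t₂.elt_notMem := by
    rintro t₁ t₂ ⟨M₃, f₁, f₂, hf₁, hf₂, he⟩ N₁ N₂ h₁ h₂ ha₁ ha₂ hle₁ hle₂
    have hN₁ : K.MemCard μ N₁ := ⟨(K.mem_of_le h₁.1).2, h₁.2.2⟩
    have hN₂ : K.MemCard μ N₂ := ⟨(K.mem_of_le h₂.1).2, h₂.2.2⟩
    obtain ⟨P, hP, -, ⟨P₁, hP₁, hle₁⟩, ⟨P₂, hP₂, hle₂⟩⟩ := isEmb_exists_between hL hK h0 hμ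
      hN₁ hN₂ (hf₁.1.le_source hle₁) (hf₂.1.le_source hle₂)
    exact Quot.sound ⟨P, f₁, f₂, ⟨⟨P₁, hP₁, hle₁, (hN₁.iso hP₁).2, hP.2⟩, hf₁.2⟩,
      ⟨⟨P₂, hP₂, hle₂, (hN₂.iso hP₂).2, hP.2⟩, hf₂.2⟩, he⟩
  intro t₁ t₂ h
  induction h with
  | rel t₁ t₂ h => exact hrel t₁ t₂ h
  | refl t =>
    have := K.le_refl (K.mem_of_le t.le_top).2
    exact hrel t t ⟨t.top, id, id, IsEmbOver.of_le this, IsEmbOver.of_le this, rfl⟩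
  | symm t₁ t₂ _ ih =>
    intro N₁ N₂ h₁ h₂ ha₁ ha₂ hle₁ hle₂
    exact (ih N₂ N₁ h₂ h₁ ha₂ ha₁ hle₂ hle₁).symm
  | trans t₁ t t₂ _ _ ih₁ ih₂ =>
    intro N₁ N₂ h₁ h₂ ha₁ ha₂ hle₁ hle₂
    obtain ⟨N, hN, hMN, hNt, hN'⟩ := hL.exists_between hK h0 hμ
      (hM.2.ge.trans (card_le_of_subset (subset_of_le t.le_top))) t.le_top hM.2.le
      (A := {t.elt}) (by simpa using t.elt_mem) (by
        rw [Cardinal.mk_singleton]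
        exact Cardinal.one_le_aleph0.trans (Cardinal.aleph0_le_lift.2 (h0.trans hμ)))
    have ha : t.elt ∈ N.carrier := hN' rfl
    have hMN' : (K.atCard μ).le M N := ⟨hMN, hM.2, hN.2⟩
    exact (ih₁ N₁ N h₁ hMN' ha₁ ha hle₁ hNt).trans (ih₂ N N₂ hMN' h₂ ha ha₂ hNt hle₂)

end AbstractClass

namespace PreFrame

open AbstractClass

/-! ### The relation `nfGE` -/

variable {L : FirstOrder.Language.{u, u}} {s : PreFrame L} {lam : Cardinal.{u}}
  {M N P B M' N' M₀ M₁ M₂ M₃ N₁ N₂ M₀' M₁' M₂' : SetModel L} {a b : ZFSet.{u}}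
  {f : ZFSet.{u} → ZFSet.{u}}

theorem nfGE.le₀₁ (h : s.nfGE lam M₀ a M₁ M₂) : s.K.le M₀ M₁ := h.2.2.2.1

theorem nfGE.le₁₂ (h : s.nfGE lam M₀ a M₁ M₂) : s.K.le M₁ M₂ := h.2.2.2.2.1

theorem nfGE.mem (h : s.nfGE lam M₀ a M₁ M₂) : a ∈ M₂.carrier := h.2.2.2.2.2.1

theorem nfGE.notMem (h : s.nfGE lam M₀ a M₁ M₂) : a ∉ M₁.carrier := h.2.2.2.2.2.2.1

/-- The model `N₀` in the definition of `nfGE` is itself a base of cardinality `lam`. -/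
theorem nfGE.exists_base (h : s.nfGE lam M₀ a M₁ M₂) :
    ∃ B, s.K.MemCard lam B ∧ s.K.le B M₀ ∧ s.nfGE lam B a M₁ M₂ := by
  obtain ⟨-, h1, h2, h01, h12, ha, ha', B, hB, hB0, H⟩ := h
  exact ⟨B, hB, hB0, hB.2.ge, h1, h2, s.K.le_trans hB0 h01, h12, ha, ha', B, hB,
    s.K.le_refl hB.1, H⟩

namespace IsSemiGoodFrame

set_option linter.unusedSectionVars false

variable (hs : s.IsSemiGoodFrame lam) (h0 : ℵ₀ ≤ lam)
include hs h0

theorem exists_between {μ : Cardinal.{u}} (hμ : lam ≤ μ) (hμN : μ ≤ N.card) (hMN : s.K.le M N)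
    (hM : M.card ≤ μ) {A : Set ZFSet.{u}} (hA : A ⊆ N.carrier)
    (hAc : #A ≤ Cardinal.lift.{u + 1} μ) :
    ∃ P, s.K.MemCard μ P ∧ s.K.le M P ∧ s.K.le P N ∧ A ⊆ P.carrier :=
  hs.lst.exists_between hs.isAEC h0 hμ hμN hMN hM hA hAc

theorem exists_between_mem {μ : Cardinal.{u}} (hμ : lam ≤ μ) (hMN : s.K.le M N)
    (hM : M.card = μ) (ha : a ∈ N.carrier) :
    ∃ P, s.K.MemCard μ P ∧ s.K.le M P ∧ s.K.le P N ∧ a ∈ P.carrier := by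
  obtain ⟨P, hP, hMP, hPN, haP⟩ := exists_between hs h0 hμ
    (hM.ge.trans (card_le_of_subset (subset_of_le hMN))) hMN hM.le
    (A := {a}) (by simpa using ha) (by
      rw [Cardinal.mk_singleton]
      exact Cardinal.one_le_aleph0.trans (Cardinal.aleph0_le_lift.2 (h0.trans hμ)))
  exact ⟨P, hP, hMP, hPN, haP rfl⟩

theorem exists_common {μ : Cardinal.{u}} (hμ : lam ≤ μ) (h₁ : s.K.MemCard μ M₁)
    (h₂ : s.K.MemCard μ M₂) (h₁N : s.K.le M₁ N) (h₂N : s.K.le M₂ N) :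
    ∃ P, s.K.MemCard μ P ∧ s.K.le M₁ P ∧ s.K.le M₂ P ∧ s.K.le P N := by
  obtain ⟨P, hP, h1, hPN, h2⟩ := exists_between hs h0 hμ
    (h₁.2.ge.trans (card_le_of_subset (subset_of_le h₁N))) h₁N h₁.2.le (subset_of_le h₂N)
    (mk_carrier_le h₂ le_rfl)
  exact ⟨P, hP, h1, hs.isAEC.coherent.le_of_subset h₂N hPN h2, hPN⟩

/-- Monotonicity of `nfGE` in models of arbitrary cardinality. Witnesses in the new top `M₂'` are
compared with the given ones in `M₂` inside a small submodel of `M₃`. -/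
theorem nfGE_mono (h : s.nfGE lam M₀ a M₁ M₂) (h₀ : s.K.le M₀ M₀') (h₀₁ : s.K.le M₀' M₁')
    (h₁ : s.K.le M₁' M₁) (h₂ : s.K.le M₂ M₃) (h₂' : s.K.le M₂' M₃)
    (hsub : M₁'.carrier ⊆ M₂'.carrier) (ha : a ∈ M₂'.carrier) :
    s.nfGE lam M₀' a M₁' M₂' := by
  obtain ⟨hc0, hc1, hc2, h01, h12, ha₂, ha₁, B, hB, hB0, H⟩ := h
  have h1₂ : s.K.le M₁' M₃ := s.K.le_trans h₁ (s.K.le_trans h12 h₂)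
  have h₁₂' : s.K.le M₁' M₂' := hs.isAEC.coherent.le_of_subset h1₂ h₂' hsub
  have hc0' : lam ≤ M₀'.card := hc0.trans (card_le_of_subset (subset_of_le h₀))
  have hc1' : lam ≤ M₁'.card := hc0'.trans (card_le_of_subset (subset_of_le h₀₁))
  have hc2' : lam ≤ M₂'.card := hc1'.trans (card_le_of_subset hsub)
  refine ⟨hc0', hc1', hc2', h₀₁, h₁₂', ha, fun h => ha₁ (subset_of_le h₁ h), B, hB,
    s.K.le_trans hB0 h₀, fun N hN hBN hNM => ?_⟩
  obtain ⟨M', hM', hNM', haM', hM'₂, hnf⟩ := H N hN hBN (s.K.le_trans hNM h₁)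
  have hNM₂' := s.K.le_trans hNM h₁₂'
  obtain ⟨P, hP, hNP, hP₂, haP⟩ := exists_between_mem hs h0 le_rfl hNM₂' hN.2 ha
  obtain ⟨Q, hQ, hM'Q, hPQ, -⟩ := exists_common hs h0 le_rfl hM' hP (s.K.le_trans hM'₂ h₂)
    (s.K.le_trans hP₂ h₂')
  exact ⟨P, hP, hNP, haP, hP₂, hs.frame.monotonicity a B B N N M' Q P hB hN hQ hP
    (s.K.le_refl hB.1) hBN (s.K.le_refl hN.1) hNM' hM'Q hPQ (subset_of_le hNP) haP hnf⟩

theorem nfGE_base (h : s.nfGE lam M₀ a M₁ M₂) (h₀ : s.K.le M₀ M₀') (h₀₁ : s.K.le M₀' M₁) :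
    s.nfGE lam M₀' a M₁ M₂ :=
  nfGE_mono hs h0 h h₀ h₀₁ (s.K.le_refl (s.K.mem_of_le h₀₁).2)
    (s.K.le_refl (s.K.mem_of_le h.le₁₂).2) (s.K.le_refl (s.K.mem_of_le h.le₁₂).2)
    (subset_of_le h.le₁₂) h.mem

theorem nfGE_mid (h : s.nfGE lam M₀ a M₁ M₂) (h₀₁ : s.K.le M₀ M₁') (h₁ : s.K.le M₁' M₁) :
    s.nfGE lam M₀ a M₁' M₂ :=
  nfGE_mono hs h0 h (s.K.le_refl (s.K.mem_of_le h₀₁).1) h₀₁ h₁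
    (s.K.le_refl (s.K.mem_of_le h.le₁₂).2) (s.K.le_refl (s.K.mem_of_le h.le₁₂).2)
    ((subset_of_le h₁).trans (subset_of_le h.le₁₂)) h.mem

theorem nfGE_top (h : s.nfGE lam M₀ a M₁ M₂) (h₂ : s.K.le M₂ M₃) :
    s.nfGE lam M₀ a M₁ M₃ :=
  nfGE_mono hs h0 h (s.K.le_refl (s.K.mem_of_le h.le₀₁).1) h.le₀₁
    (s.K.le_refl (s.K.mem_of_le h.le₁₂).1) h₂ (s.K.le_refl (s.K.mem_of_le h₂).2)
    ((subset_of_le h.le₁₂).trans (subset_of_le h₂)) (subset_of_le h₂ h.mem)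

theorem nfGE_of_top (h : s.nfGE lam M₀ a M₁ M₃) (h₁₂ : s.K.le M₁ M₂) (h₂ : s.K.le M₂ M₃)
    (ha : a ∈ M₂.carrier) : s.nfGE lam M₀ a M₁ M₂ :=
  nfGE_mono hs h0 h (s.K.le_refl (s.K.mem_of_le h.le₀₁).1) h.le₀₁
    (s.K.le_refl (s.K.mem_of_le h.le₁₂).1) (s.K.le_refl (s.K.mem_of_le h₂).2) h₂
    (subset_of_le h₁₂) ha

/-- On models of cardinality `lam`, the relation `nfGE` is the original non-forking relation. -/
theorem nfGE_iff_nf (h₀ : s.K.MemCard lam M₀) (h₁ : s.K.MemCard lam M₁)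
    (h₂ : s.K.MemCard lam M₂) : s.nfGE lam M₀ a M₁ M₂ ↔ s.nf M₀ a M₁ M₂ := by
  constructor
  · rintro ⟨-, -, -, h01, h12, ha, -, B, hB, hB0, H⟩
    obtain ⟨M', hM', h1M', haM', hM'₂, hnf⟩ := H M₁ h₁ (s.K.le_trans hB0 h01) (s.K.le_refl h₁.1)
    exact hs.frame.monotonicity a B M₀ M₁ M₁ M' M₂ M₂ h₀ h₁ h₂ h₂ hB0 h01 (s.K.le_refl h₁.1) h1M'
      hM'₂ (s.K.le_refl h₂.1) (subset_of_le h12) ha hnf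
  · intro h
    obtain ⟨-, -, -, h01, h12, ha, ha', -, -⟩ := hs.frame.nfBasic _ _ _ _ h
    refine ⟨h₀.2.ge, h₁.2.ge, h₂.2.ge, h01, h12, ha, ha', M₀, h₀, s.K.le_refl h₀.1,
      fun N hN h0N hN1 => ⟨M₂, h₂, s.K.le_trans hN1 h12, ha, s.K.le_refl h₂.1, ?_⟩⟩
    exact hs.frame.monotonicity a M₀ M₀ N M₁ M₂ M₂ M₂ h₀ hN h₂ h₂ (s.K.le_refl h₀.1) h0N hN1 h12
      (s.K.le_refl h₂.1) (s.K.le_refl h₂.1) (subset_of_le (s.K.le_trans hN1 h12)) ha h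

theorem nfGE_of_nf (h : s.nf M₀ a M₁ M₂) : s.nfGE lam M₀ a M₁ M₂ := by
  obtain ⟨h₀, h₁, h₂, -⟩ := hs.frame.nfBasic _ _ _ _ h
  exact (nfGE_iff_nf hs h0 h₀ h₁ h₂).2 h

/-- Small submodels of `M₁'` are pulled back to `M₁`, and the witnesses pushed forward. -/
theorem nfGE_iso (h : s.nfGE lam M₀ a M₁ M₂) (hf₀ : IsIso f M₀ M₀') (hf₁ : IsIso f M₁ M₁')
    (hf₂ : IsIso f M₂ M₂') : s.nfGE lam M₀' (f a) M₁' M₂' := by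
  obtain ⟨hc0, hc1, hc2, h01, h12, ha₂, ha₁, B, hB, hB0, H⟩ := h
  obtain ⟨B', hB', hB'0⟩ := exists_le_of_isIso hB0 hf₀
  refine ⟨hf₀.card_eq ▸ hc0, hf₁.card_eq ▸ hc1, hf₂.card_eq ▸ hc2, s.K.le_iso h01 hf₁ hf₀,
    s.K.le_iso h12 hf₂ hf₁, hf₂.mem ha₂, fun h => ?_, B', hB.iso hB', hB'0,
    fun N' hN' hBN' hNM' => ?_⟩
  · obtain ⟨x, hx, hxa⟩ := hf₁.exists_of_mem h
    exact ha₁ (hf₂.injOn (subset_of_le h12 hx) ha₂ hxa ▸ hx)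
  · obtain ⟨g, hg, hgf, hfg⟩ := hf₁.symm
    obtain ⟨N, hN, hNM⟩ := exists_le_of_isIso hNM' hg
    have hfN : IsIso f N N' := by
      obtain ⟨k, hk, hkg, hgk⟩ := hN.symm
      refine hk.congr fun x hx => ?_
      obtain ⟨y, hy, rfl⟩ := hN.exists_of_mem hx
      rw [hkg y hy, hfg y (subset_of_le hNM' hy)]
    have hBN : s.K.le B N := by
      refine hs.isAEC.coherent.le_of_subset (s.K.le_trans hB0 h01) hNM fun x hx => ?_
      have := hN.mem (subset_of_le hBN' (hB'.mem hx))
      rwa [hgf x (subset_of_le (s.K.le_trans hB0 h01) hx)] at this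
    obtain ⟨P, hP, hNP, haP, hP₂, hnf⟩ := H N (hN'.iso hN) hBN hNM
    obtain ⟨P', hP', hP₂'⟩ := exists_le_of_isIso hP₂ hf₂
    exact ⟨P', hP.iso hP', s.K.le_iso hNP hP' hfN, hP'.mem haP, hP₂',
      hs.frame.nfIso f a B N P B' N' P' hB' hfN hP' hnf⟩

theorem nfGE_of_eStar {t₁ t₂ : s.K.Triple M₁} (h : Triple.EStar t₁ t₂)
    (hn : s.nfGE lam M₀ t₁.elt M₁ t₁.top) : s.nfGE lam M₀ t₂.elt M₁ t₂.top := by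
  obtain ⟨M₃, f₁, f₂, ⟨⟨P₁, hP₁, hle₁⟩, hf₁⟩, ⟨⟨P₂, hP₂, hle₂⟩, hf₂⟩, he⟩ := h
  have hle := subset_of_le hn.le₀₁
  have hn' := nfGE_iso hs h0 hn (IsIso.of_fixed fun x hx => hf₁ x (hle hx))
    (IsIso.of_fixed hf₁) hP₁
  rw [he] at hn'
  have h₂ : s.K.le M₁ P₂ := s.K.le_iso t₂.le_top hP₂ (IsIso.of_fixed hf₂)
  have hn₂ := nfGE_of_top hs h0 (nfGE_top hs h0 hn' hle₁) h₂ hle₂ (hP₂.mem t₂.elt_mem)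
  -- The relation is carried back from the image `P₂` along the inverse of `f₂`.
  obtain ⟨g, hg, hgf, -⟩ := hP₂.symm
  have hg' : ∀ x ∈ M₁.carrier, g x = x := fun x hx => by
    have := hgf x (subset_of_le t₂.le_top hx)
    rwa [hf₂ x hx] at this
  have := nfGE_iso hs h0 hn₂ (IsIso.of_fixed fun x hx => hg' x (hle hx)) (IsIso.of_fixed hg') hg
  rwa [hgf _ t₂.elt_mem] at this

/-- Whether `nfGE` holds of a triple depends only on its type. -/
theorem nfGE_of_mk_eq {t₁ t₂ : s.K.Triple M₁}
    (h : Quot.mk Triple.EStar t₁ = Quot.mk Triple.EStar t₂)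
    (hn : s.nfGE lam M₀ t₁.elt M₁ t₁.top) : s.nfGE lam M₀ t₂.elt M₁ t₂.top := by
  have hsymm : ∀ t t' : s.K.Triple M₁, Triple.EStar t t' → Triple.EStar t' t := by
    rintro t t' ⟨M₃, f₁, f₂, h₁, h₂, he⟩
    exact ⟨M₃, f₂, f₁, h₂, h₁, he.symm⟩
  have : s.nfGE lam M₀ t₁.elt M₁ t₁.top ↔ s.nfGE lam M₀ t₂.elt M₁ t₂.top := by
    replace h := Quot.eqvGen_exact h
    clear hn
    induction h with
    | rel t t' h => exact ⟨nfGE_of_eStar hs h0 h, nfGE_of_eStar hs h0 (hsymm _ _ h)⟩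
    | refl t => exact Iff.rfl
    | symm _ _ _ ih => exact ih.symm
    | trans _ _ _ _ _ ih₁ ih₂ => exact ih₁.trans ih₂
  exact this.1 hn

theorem doesNotForkGE_tp_iff (h : s.K.le M₁ M₂) (ha : a ∈ M₂.carrier) (ha' : a ∉ M₁.carrier) :
    s.DoesNotForkGE lam (tp h ha ha') M₀ ↔ s.nfGE lam M₀ a M₁ M₂ :=
  ⟨fun ⟨_, ht, hn⟩ => nfGE_of_mk_eq hs h0 ht hn, fun hn => ⟨⟨M₂, a, h, ha, ha'⟩, rfl, hn⟩⟩

theorem doesNotFork_tp_iff (h : s.K.le M₁ M₂) (ha : a ∈ M₂.carrier) (ha' : a ∉ M₁.carrier)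
    (hM₂ : s.K.MemCard lam M₂) :
    s.DoesNotFork (tp h ha ha') M₀ ↔ s.nf M₀ a M₁ M₂ := by
  refine ⟨?_, fun hn => ⟨⟨M₂, a, h, ha, ha'⟩, rfl, hn⟩⟩
  rintro ⟨t, ht, hn⟩
  obtain ⟨h₀, h₁, -⟩ := hs.frame.nfBasic _ _ _ _ hn
  exact (nfGE_iff_nf hs h0 h₀ h₁ hM₂).1
    (nfGE_of_mk_eq hs h0 (t₂ := ⟨M₂, a, h, ha, ha'⟩) ht (nfGE_of_nf hs h0 hn))

/-- For a base of cardinality `lam`, non-forking may be checked on submodels of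
cardinality `lam`. -/
theorem nfGE_of_forall (hB : s.K.MemCard lam B) (hB₁ : s.K.le B M₁) (h₁₂ : s.K.le M₁ M₂)
    (ha : a ∈ M₂.carrier) (ha' : a ∉ M₁.carrier)
    (H : ∀ N, s.K.MemCard lam N → s.K.le B N → s.K.le N M₁ → s.nfGE lam B a N M₂) :
    s.nfGE lam B a M₁ M₂ := by
  have h1 : lam ≤ M₁.card := hB.2.ge.trans (card_le_of_subset (subset_of_le hB₁))
  refine ⟨hB.2.ge, h1, h1.trans (card_le_of_subset (subset_of_le h₁₂)), hB₁, h₁₂, ha, ha', B, hB,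
    s.K.le_refl hB.1, fun N hN hBN hN₁ => ?_⟩
  have hn := H N hN hBN hN₁
  obtain ⟨P, hP, hNP, hP₂, haP⟩ := exists_between_mem hs h0 le_rfl hn.le₁₂ hN.2 ha
  exact ⟨P, hP, hNP, haP, hP₂, (nfGE_iff_nf hs h0 hB hN hP).1 (nfGE_of_top hs h0 hn hNP hP₂ haP)⟩

/-- Transitivity of non-forking in cardinality `lam`, from the uniqueness and the existence of
non-forking extensions. -/
theorem nf_trans (h₁ : s.nf M₀ a M₁ M₃) (h₂ : s.nf M₁ a M₂ M₃) : s.nf M₀ a M₂ M₃ := by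
  obtain ⟨hM₀, hM₁, -, h01, h13, ha, ha', hb₁, hb₀⟩ := hs.frame.nfBasic _ _ _ _ h₁
  obtain ⟨-, hM₂, hM₃, h12, h23, -, ha'', -, -⟩ := hs.frame.nfBasic _ _ _ _ h₂
  obtain ⟨q, -, ⟨t, rfl, hn⟩, hq⟩ := hs.frame.extension M₀ M₂ (s.K.le_trans h01 h12) hM₀ hM₂ _ hb₀
  have hn' := nfGE_of_nf hs h0 hn
  obtain ⟨-, -, ht, -⟩ := hs.frame.nfBasic _ _ _ _ hn
  -- `q` extends the type of `a` over `M₀` freely to `M₂`; uniqueness identifies it with the type of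
  -- `a` first over `M₁` and then over `M₂`.
  have e₁ : (tp h23 ha ha'').restrict h12 = GType.restrict h12 (Quot.mk _ t) := by
    refine hs.frame.uniqueness M₀ M₁ h01 hM₀ hM₁ _ _ ⟨⟨M₃, a, h13, ha, ha'⟩, rfl, h₁⟩
      ⟨⟨t.top, t.elt, s.K.le_trans h12 t.le_top, t.elt_mem,
        fun h => t.elt_notMem (subset_of_le h12 h)⟩, rfl, ?_⟩ ?_
    · exact (nfGE_iff_nf hs h0 hM₀ hM₁ ht).1 (nfGE_mid hs h0 hn' h01 h12)
    · exact hq.symm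
  have e₂ : tp h23 ha ha'' = Quot.mk _ t :=
    hs.frame.uniqueness M₁ M₂ h12 hM₁ hM₂ _ _ ⟨⟨M₃, a, h23, ha, ha''⟩, rfl, h₂⟩
      ⟨t, rfl, (nfGE_iff_nf hs h0 hM₁ hM₂ ht).1 (nfGE_base hs h0 hn' h01 h12)⟩ e₁
  exact (doesNotFork_tp_iff hs h0 h23 ha ha'' hM₃).1 ⟨t, e₂.symm, hn⟩

/-- Transitivity of `nfGE` over a middle model of cardinality `lam`. -/
theorem nfGE_trans (hB : s.K.MemCard lam B) (hN : s.K.MemCard lam N)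
    (h₁ : s.nfGE lam B a N M₂) (h₂ : s.nfGE lam N a M₁ M₂) : s.nfGE lam B a M₁ M₂ := by
  refine nfGE_of_forall hs h0 hB (s.K.le_trans h₁.le₀₁ h₂.le₀₁) h₂.le₁₂ h₂.mem h₂.notMem
    fun P hP hBP hP₁ => ?_
  obtain ⟨Q, hQ, hPQ, hNQ, hQ₁⟩ := exists_common hs h0 le_rfl hP hN hP₁ h₂.le₀₁
  obtain ⟨R, hR, hQR, hR₂, haR⟩ := exists_between_mem hs h0 le_rfl (s.K.le_trans hQ₁ h₂.le₁₂) hQ.2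
    h₂.mem
  have h₃ := nf_trans hs h0
    ((nfGE_iff_nf hs h0 hB hN hR).1 (nfGE_of_top hs h0 h₁ (s.K.le_trans hNQ hQR) hR₂ haR))
    ((nfGE_iff_nf hs h0 hN hQ hR).1 (nfGE_of_top hs h0 (nfGE_mid hs h0 h₂ hNQ hQ₁) hQR hR₂ haR))
  exact nfGE_mid hs h0 (nfGE_top hs h0 (nfGE_of_nf hs h0 h₃) hR₂) hBP hPQ

/-- Transitivity over a middle model `M₀` of arbitrary cardinality: it reduces to `nfGE_trans` with
a small middle model that contains `B` and a base for non-forking over `M₀`. -/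
theorem nfGE_trans_base (hB : s.K.MemCard lam B) (h₁ : s.nfGE lam B a M₀ M₂)
    (h₂ : s.nfGE lam M₀ a M₁ M₂) : s.nfGE lam B a M₁ M₂ := by
  obtain ⟨C, hC, hC₀, h₃⟩ := h₂.exists_base
  obtain ⟨D, hD, hBD, hCD, hD₀⟩ := exists_common hs h0 le_rfl hB hC h₁.le₀₁ hC₀
  exact nfGE_trans hs h0 hB hD (nfGE_mid hs h0 h₁ hBD hD₀)
    (nfGE_base hs h0 h₃ hCD (s.K.le_trans hD₀ h₂.le₀₁))

/-- The basic types over a model of cardinality `lam` are those that do not fork over it. -/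
theorem nf_self (hM : s.K.MemCard lam M) (hN : s.K.MemCard lam N) (h : s.K.le M N)
    (ha : a ∈ N.carrier) (ha' : a ∉ M.carrier) (hb : tp h ha ha' ∈ s.bs M) : s.nf M a M N := by
  obtain ⟨q, -, hq, he⟩ := hs.frame.extension M M (s.K.le_refl hM.1) hM hM _ hb
  rw [GType.restrict_refl] at he
  exact (doesNotFork_tp_iff hs h0 h ha ha' hN).1 (he ▸ hq)

end IsSemiGoodFrame

end PreFrame

namespace AbstractClass

/-! ### Filtrations -/

variable {L : FirstOrder.Language.{u, u}} {K : AbstractClass L}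
  {M N P B C : SetModel L} {lam : Cardinal.{u}}

theorem isSuccLimit_succ_ord (h0 : ℵ₀ ≤ lam) : Order.IsSuccLimit (Order.succ lam).ord :=
  Cardinal.isSuccLimit_ord (h0.trans (Order.le_succ lam))

theorem HasLST.exists_filtration (hL : K.HasLST lam) (hK : K.IsAEC) (h0 : ℵ₀ ≤ lam)
    (hM : K.MemCard (Order.succ lam) M) (hB : K.MemCard lam B) (hBM : K.le B M) :
    ∃ Ms, K.IsFiltration lam Ms M ∧ Ms 0 = B := by
  obtain ⟨e, he, heM⟩ := exists_enum hM.2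
  obtain ⟨A, hA0, hA, hAT, hAΦ⟩ := hL.exists_chain hK h0 le_rfl (fun _ => M)
    (fun _ _ _ _ => K.le_refl hM.1) (fun α _ => {e α}) (fun α A hα _ _ =>
      ⟨Set.singleton_subset_iff.2 (heM α ((Order.lt_add_one_iff.2 le_rfl).trans hα)), by
        rw [Cardinal.mk_singleton]
        exact Cardinal.one_le_aleph0.trans (Cardinal.aleph0_le_lift.2 h0)⟩) hB hBM
  refine ⟨A, ⟨hA, fun α hα => (hAT α hα).1.2, fun α hα => K.le_sub (hAT α hα).2, fun x =>
    ⟨fun hx => ?_, fun ⟨α, hα, hx⟩ => subset_of_le (hAT α hα).2 hx⟩⟩, hA0⟩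
  obtain ⟨α, hα, rfl⟩ := he x hx
  have hα' := (isSuccLimit_succ_ord h0).add_one_lt hα
  exact ⟨α + 1, hα', hAΦ α hα' rfl⟩

theorem IsFiltration.le (hK : K.IsAEC) (h0 : ℵ₀ ≤ lam) {Ms : Ordinal.{u} → SetModel L}
    (h : K.IsFiltration lam Ms M) : ∀ α < (Order.succ lam).ord, K.le (Ms α) M :=
  (hK.union _ Ms M trivial (isSuccLimit_succ_ord h0) h.1 h.2.2).2

theorem IsFiltration.memCard (hK : K.IsAEC) (h0 : ℵ₀ ≤ lam) {Ms : Ordinal.{u} → SetModel L}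
    (h : K.IsFiltration lam Ms M) {α : Ordinal.{u}} (hα : α < (Order.succ lam).ord) :
    K.MemCard lam (Ms α) :=
  ⟨(K.mem_of_le (h.le hK h0 α hα)).1, h.2.1 α hα⟩

/-- Since `λ⁺` is regular, each submodel of cardinality `λ` is contained in some member of a
filtration. -/
theorem IsFiltration.exists_le (hK : K.IsAEC) (h0 : ℵ₀ ≤ lam) {Ms : Ordinal.{u} → SetModel L}
    (h : K.IsFiltration lam Ms M) (hN : K.MemCard lam N) (hNM : K.le N M) :
    ∃ α < (Order.succ lam).ord, K.le N (Ms α) := by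
  have H : ∀ x : Shrink.{u} N.carrier, ∃ α < (Order.succ lam).ord,
      (((equivShrink N.carrier).symm x : N.carrier) : ZFSet) ∈ (Ms α).carrier := fun x =>
    (h.2.2.2 _).1 (subset_of_le hNM (Subtype.mem _))
  choose r hr hr' using H
  have hsup : (⨆ x, r x) < (Order.succ lam).ord := by
    refine Ordinal.iSup_lt_of_lt_cof ?_ hr
    rw [(Cardinal.isRegular_succ h0).cof_ord]
    have : #(Shrink.{u} N.carrier) = lam := hN.2
    rw [this]
    exact Order.lt_succ lam
  refine ⟨_, hsup, hK.coherent.le_of_subset hNM (h.le hK h0 _ hsup) fun x hx => ?_⟩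
  have := hr' (equivShrink _ ⟨x, hx⟩)
  rw [Equiv.symm_apply_apply] at this
  exact subset_of_le (h.1.1 _ _ (Ordinal.le_iSup r _) hsup) this

/-- Reflection of a small submodel `N` of the union of a chain of large models: either `N` is
contained in a proper member of the chain, or it is contained in the union of a short chain of
small models each of which is contained in some member. In the second case the length of the short
chain is the least `κ` such that the first `κ` elements of `N` are unbounded in the chain. -/
theorem HasLST.exists_reflection (hL : K.HasLST lam) (hK : K.IsAEC) (h0 : ℵ₀ ≤ lam)
    {δ : Ordinal.{u}} {Ms : Ordinal.{u} → SetModel L} (hδ : Order.IsSuccLimit δ)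
    (hM : K.IsIncCont (δ + 1) Ms) (hN : K.MemCard lam N) (hNM : K.le N (Ms δ))
    (hB : K.MemCard lam B) (hBM : K.le B (Ms 0)) :
    (∃ α < δ, K.le N (Ms α)) ∨ ∃ (κ : Ordinal.{u}) (Ns : Ordinal.{u} → SetModel L),
      κ < (Order.succ lam).ord ∧ Order.IsSuccLimit κ ∧ K.IsIncCont (κ + 1) Ns ∧ Ns 0 = B ∧
      (∀ i ≤ κ, K.MemCard lam (Ns i)) ∧ (∀ i < κ, ∃ α < δ, K.le (Ns i) (Ms α)) ∧
      K.le (Ns κ) (Ms δ) ∧ K.le N (Ns κ) := by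
  have hδ1 : δ < δ + 1 := Order.lt_add_one_iff.2 le_rfl
  have hδ0 : 0 < δ := pos_iff_ne_zero.2 hδ.ne_bot
  have hle : ∀ α β, α ≤ β → β ≤ δ → K.le (Ms α) (Ms β) := fun α β h h' =>
    hM.1 α β h (Order.lt_add_one_iff.2 h')
  have hU := hM.2 δ hδ1 hδ
  by_cases hbd : ∃ α < δ, K.le N (Ms α)
  · exact Or.inl hbd
  right
  obtain ⟨e, he, heN⟩ := exists_enum hN.2
  have hr : ∀ j, ∃ α < δ, j < lam.ord → e j ∈ (Ms α).carrier := fun j => by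
    by_cases hj : j < lam.ord
    · obtain ⟨α, hα, h⟩ := (hU.2 _).1 (subset_of_le hNM (heN j hj))
      exact ⟨α, hα, fun _ => h⟩
    · exact ⟨0, hδ0, fun h => absurd h hj⟩
  -- `r j` is an index below `δ` of a member containing the `j`-th element of `N`, and `g i ≤ δ` is
  -- the supremum of the ordinals `r j + 1` with `j < i`.
  choose r hrδ hr using hr
  let G : Ordinal.{u} → Set Ordinal.{u} := fun i => {α | ∀ j < i, r j < α}
  have hG : ∀ i, δ ∈ G i := fun i j _ => hrδ j
  let g : Ordinal.{u} → Ordinal.{u} := fun i => sInf (G i)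
  have hgδ : ∀ i, g i ≤ δ := fun i => csInf_le' (hG i)
  have hgG : ∀ i, g i ∈ G i := fun i => csInf_mem ⟨δ, hG i⟩
  have hgmono : ∀ i j, i ≤ j → g i ≤ g j := fun i j hij =>
    csInf_le' fun k hk => hgG j k (hk.trans_le hij)
  have hglam : g lam.ord = δ := by
    refine (hgδ _).eq_or_lt.resolve_right fun hlt => hbd ⟨_, hlt, ?_⟩
    refine hK.coherent.le_of_subset hNM (hle _ _ hlt.le le_rfl) fun x hx => ?_
    obtain ⟨j, hj, rfl⟩ := he x hx
    exact subset_of_le (hle _ _ (hgG _ j hj).le hlt.le) (hr j hj)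
  let κ : Ordinal.{u} := sInf {i | g i = δ}
  have hκ : g κ = δ := csInf_mem (s := {i | g i = δ}) ⟨_, hglam⟩
  have hlt : ∀ i < κ, g i < δ := fun i hi => (hgδ i).lt_of_ne fun h => notMem_of_lt_csInf' hi h
  have hκlam : κ < (Order.succ lam).ord :=
    (csInf_le' hglam : κ ≤ lam.ord).trans_lt (Cardinal.ord_lt_ord.2 (Order.lt_succ lam))
  have hκl : Order.IsSuccLimit κ := by
    rcases Ordinal.zero_or_succ_or_isSuccLimit κ with h | ⟨i, h⟩ | h
    · have : g κ ≤ 0 := csInf_le' fun j hj => by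
        rw [h] at hj
        exact absurd hj not_lt_zero
      rw [hκ] at this
      exact absurd this hδ0.not_ge
    · have hi : i < κ := h ▸ Order.lt_succ i
      have : g κ ≤ max (g i) (r i + 1) := csInf_le' fun j hj => by
        rw [← h] at hj
        rcases (Order.lt_succ_iff.1 hj).eq_or_lt with rfl | hj
        · exact lt_max_of_lt_right (Order.lt_add_one_iff.2 le_rfl)
        · exact lt_max_of_lt_left (hgG i j hj)
      rw [hκ] at this
      exact absurd this (max_lt (hlt i hi) (hδ.add_one_lt (hrδ i))).not_ge
    · exact h
  obtain ⟨A, hA0, hA, hAT, hAΦ⟩ := hL.exists_chain hK h0 (θ := κ + 1)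
    ((isSuccLimit_succ_ord h0).add_one_lt hκlam).le (fun i => Ms (g i))
    (fun i j hij _ => hle _ _ (hgmono i j hij) (hgδ j))
    (fun i _ => N.carrier ∩ (Ms (g (i + 1))).carrier)
    (fun i A _ _ _ => ⟨Set.inter_subset_right,
      (Cardinal.mk_le_mk_of_subset Set.inter_subset_left).trans (mk_carrier_le hN le_rfl)⟩)
    hB (K.le_trans hBM (hle _ _ zero_le (hgδ 0)))
  have hκ1 : κ < κ + 1 := Order.lt_add_one_iff.2 le_rfl
  have hAκ : K.le (A κ) (Ms δ) := by
    have := (hAT κ hκ1).2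
    rwa [hκ] at this
  refine ⟨κ, A, hκlam, hκl, hA, hA0, fun i hi => (hAT i (Order.lt_add_one_iff.2 hi)).1,
    fun i hi => ⟨g i, hlt i hi, (hAT i (hi.trans hκ1)).2⟩, hAκ,
    hK.coherent.le_of_subset hNM hAκ fun x hx => ?_⟩
  obtain ⟨ρ, hρ, hxρ⟩ := (hU.2 x).1 (subset_of_le hNM hx)
  have : ∃ i < κ, ρ ≤ r i := by
    by_contra! hcon
    exact absurd (csInf_le' hcon : g κ ≤ ρ) (hκ ▸ hρ).not_ge
  obtain ⟨i, hi, hρi⟩ := this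
  have hi' : i + 1 < κ := hκl.add_one_lt hi
  refine subset_of_le (hA.1 (i + 1) κ hi'.le hκ1) (hAΦ i (hi'.trans hκ1) ⟨hx, ?_⟩)
  exact subset_of_le (hle _ _ (hρi.trans (hgG (i + 1) i (Order.lt_add_one_iff.2 le_rfl)).le)
    (hgδ _)) hxρ

/-! ### Limits of directed systems of embeddings -/

/-- An increasing sequence of embeddings `fs α : Ms α → Ns α` with images `Ps α` has a limit, an
embedding of the union of the sequence `Ms` into the union of the sequence `Ns`. -/
theorem IsAEC.exists_limit_iso (hK : K.IsAEC) {δ : Ordinal.{u}} (hδ : Order.IsSuccLimit δ)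
    {Ms Ps Ns : Ordinal.{u} → SetModel L} {fs : Ordinal.{u} → ZFSet.{u} → ZFSet.{u}}
    (hM : K.IsIncCont δ Ms) (hMU : IsUnion Ms δ M) (hN : K.IsIncCont δ Ns) (hNU : IsUnion Ns δ N)
    (hf : ∀ α < δ, IsIso (fs α) (Ms α) (Ps α)) (hP : ∀ α < δ, K.le (Ps α) (Ns α))
    (hfs : ∀ β α, β < α → α < δ → ∀ x ∈ (Ms β).carrier, fs α x = fs β x) :
    ∃ f P, IsIso f M P ∧ (∀ α < δ, ∀ x ∈ (Ms α).carrier, f x = fs α x) ∧ K.IsIncCont δ Ps ∧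
      IsUnion Ps δ P ∧ K.le P N := by
  classical
  let f : ZFSet.{u} → ZFSet.{u} := fun x =>
    if h : ∃ α < δ, x ∈ (Ms α).carrier then fs h.choose x else x
  have hff : ∀ α < δ, ∀ x ∈ (Ms α).carrier, f x = fs α x := by
    intro α hα x hx
    have h : ∃ α < δ, x ∈ (Ms α).carrier := ⟨α, hα, hx⟩
    simp only [f, dif_pos h]
    rcases lt_trichotomy h.choose α with hlt | heq | hlt
    · exact (hfs _ _ hlt hα x h.choose_spec.2).symm
    · rw [heq]
    · exact hfs _ _ hlt h.choose_spec.1 x hx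
  have hfi : ∀ α < δ, IsIso f (Ms α) (Ps α) := fun α hα =>
    (hf α hα).congr fun x hx => (hff α hα x hx).symm
  have hinj : Set.InjOn f M.carrier := by
    intro x hx y hy
    obtain ⟨α, hα, hx⟩ := (hMU.2 x).1 hx
    obtain ⟨β, hβ, hy⟩ := (hMU.2 y).1 hy
    have hm := max_lt hα hβ
    exact (hfi _ hm).injOn (subset_of_le (hM.1 α _ (le_max_left α β) hm) hx)
      (subset_of_le (hM.1 β _ (le_max_right α β) hm) hy)
  obtain ⟨P, hP'⟩ := exists_isIso M hinj
  have hinc : K.IsIncCont δ Ps := ⟨fun α β hαβ hβ => K.le_iso (hM.1 α β hαβ hβ) (hfi β hβ)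
    (hfi α (hαβ.trans_lt hβ)), fun γ hγ hl => (hM.2 γ hγ hl).iso (hfi γ hγ)
      fun α hα => hfi α (hα.trans hγ)⟩
  have hPU : IsUnion Ps δ P := hMU.iso hP' hfi
  refine ⟨f, P, hP', hff, hinc, hPU, hK.smooth δ Ps P N trivial hδ hinc hPU fun α hα =>
    K.le_trans (hP α hα) ((hK.union δ Ns N trivial hδ hN hNU).2 α hα)⟩

/-- Given a filtration of `M`, an extension `C` of its first member and an invariant `Q` that can be
prolonged at successor steps and passes to unions, `M` embeds over that first member into a model
`N ⪰ C` filtered by models related by `Q` to the images of the members of the filtration. -/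
theorem IsAEC.exists_direct_limit (hK : K.IsAEC) (h0 : ℵ₀ ≤ lam)
    (hM : K.MemCard (Order.succ lam) M) {Ms : Ordinal.{u} → SetModel L}
    (hMs : K.IsFiltration lam Ms M) (hC : K.MemCard lam C) (hBC : K.le (Ms 0) C)
    (Q : SetModel L → SetModel L → Prop) (hQ : Q (Ms 0) C)
    (hstep : ∀ P N P', K.MemCard lam P → K.MemCard lam N → K.MemCard lam P' → K.le P N →
      K.le P P' → K.le C N → Q P N → ∃ N' h P'', K.MemCard lam N' ∧ K.le N N' ∧
        IsIso h P' P'' ∧ (∀ x ∈ P.carrier, h x = x) ∧ K.le P'' N' ∧ Q P'' N')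
    (hlim : ∀ (δ : Ordinal.{u}) (Ps Ns : Ordinal.{u} → SetModel L), δ < (Order.succ lam).ord →
      Order.IsSuccLimit δ → K.IsIncCont (δ + 1) Ps → K.IsIncCont (δ + 1) Ns →
      (∀ α ≤ δ, K.MemCard lam (Ps α) ∧ K.MemCard lam (Ns α) ∧ K.le (Ps α) (Ns α)) →
      Ps 0 = Ms 0 → Ns 0 = C → (∀ α < δ, Q (Ps α) (Ns α)) → Q (Ps δ) (Ns δ)) :
    ∃ f M' N, IsIso f M M' ∧ K.le M' N ∧ K.MemCard (Order.succ lam) N ∧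
      (∀ x ∈ (Ms 0).carrier, f x = x) ∧ K.le C N ∧ ∀ α < (Order.succ lam).ord, ∃ P Nα,
        IsIso f (Ms α) P ∧ K.le P Nα ∧ K.le Nα N ∧ Q P Nα := by
  classical
  have hθ := isSuccLimit_succ_ord h0
  have hθ0 : 0 < (Order.succ lam).ord := pos_iff_ne_zero.2 hθ.ne_bot
  have hMsc : ∀ α < (Order.succ lam).ord, K.MemCard lam (Ms α) := fun α hα => hMs.memCard hK h0 hα
  -- The terms of the sequence are triples of a model, an embedding of `Ms α` into it, and the image
  -- of this embedding.
  have : Nonempty (SetModel L × (ZFSet.{u} → ZFSet.{u}) × SetModel L) := ⟨(C, id, C)⟩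
  obtain ⟨F, hF⟩ := exists_transfinite_seq (Order.succ lam).ord
    (fun α (F : Ordinal.{u} → SetModel L × (ZFSet.{u} → ZFSet.{u}) × SetModel L) s =>
      (α = 0 → s = (C, id, Ms 0)) ∧ K.MemCard lam s.1 ∧ IsIso s.2.1 (Ms α) s.2.2 ∧
      K.le s.2.2 s.1 ∧ Q s.2.2 s.1 ∧
      (∀ β < α, K.le (F β).1 s.1 ∧ ∀ x ∈ (Ms β).carrier, s.2.1 x = (F β).2.1 x) ∧
      (Order.IsSuccLimit α → IsUnion (fun β => (F β).1) α s.1))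
    (by
      rintro α F G s h ⟨h1, h2, h3, h4, h5, h6, h7⟩
      exact ⟨h1, h2, h3, h4, h5, fun β hβ => h β hβ ▸ h6 β hβ,
        fun hl => (h7 hl).congr fun β hβ => by rw [h β hβ]⟩)
    (by
      intro α hα F hF
      rcases Ordinal.zero_or_succ_or_isSuccLimit α with rfl | ⟨β, rfl⟩ | hl
      · exact ⟨(C, id, Ms 0), fun _ => rfl, hC, IsIso.refl _, hBC, hQ,
          fun β hβ => absurd hβ not_lt_zero, fun hl => absurd rfl hl.ne_bot⟩
      · rw [Order.succ_eq_add_one] at hα hF ⊢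
        have hβ : β < β + 1 := Order.lt_add_one_iff.2 le_rfl
        obtain ⟨h1, h2, h3, h4, h5, h6, -⟩ := hF β hβ
        have hββ := hMs.1.1 β (β + 1) hβ.le hα
        obtain ⟨k, P', hk, hP', hkf⟩ := exists_iso_extending h3 hββ
        have hCN : K.le C (F β).1 := by
          rcases (zero_le (a := β)).eq_or_lt with rfl | hβ0
          · rw [h1 rfl]
            exact K.le_refl hC.1
          · have := (h6 0 hβ0).1
            rwa [(hF 0 (hβ0.trans hβ)).1 rfl] at this
        obtain ⟨N', h, P'', hN', hNN', hP'', hfix, hPN', hQ'⟩ := hstep (F β).2.2 (F β).1 P'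
          ((hMsc β (hβ.trans hα)).iso h3) h2 ((hMsc _ hα).iso hk) h4 hP' hCN h5
        refine ⟨(N', h ∘ k, P''), fun h => absurd h (ordinal_add_one_ne_zero β), hN',
          hk.trans hP'', hPN', hQ', fun γ hγ => ?_, fun hl => absurd hl (not_isSuccLimit_add_one β)⟩
        have hfk : ∀ x ∈ (Ms β).carrier, (h ∘ k) x = (F β).2.1 x := fun x hx => by
          rw [Function.comp_apply, hkf x hx, hfix _ (h3.mem hx)]
        rcases (Order.lt_add_one_iff.1 hγ).eq_or_lt with rfl | hγ
        · exact ⟨hNN', hfk⟩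
        · refine ⟨K.le_trans (h6 γ hγ).1 hNN', fun x hx => ?_⟩
          exact (hfk x (subset_of_le (hMs.1.1 γ β hγ.le (hβ.trans hα)) hx)).trans ((h6 γ hγ).2 x hx)
      · have hα0 : 0 < α := pos_iff_ne_zero.2 hl.ne_bot
        have hinc : K.IsIncCont α fun β => (F β).1 := by
          refine ⟨fun β γ hβγ hγ => ?_, fun γ hγ hl => (hF γ hγ).2.2.2.2.2.2 hl⟩
          rcases hβγ.eq_or_lt with rfl | hβγ
          · exact K.le_refl (hF _ hγ).2.1.1
          · exact ((hF γ hγ).2.2.2.2.2.1 β hβγ).1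
        obtain ⟨U, hU, hUm, hUle⟩ := hK.exists_isUnion hl hinc
        have hUc : K.MemCard lam U := ⟨hUm, card_eq_of_isUnion hl h0 (card_le_of_lt_succ_ord hα)
          (fun β hβ => (hF β hβ).2.1.2) hU⟩
        obtain ⟨f, P, hf, hff, hPinc, hPU, hPle⟩ := hK.exists_limit_iso hl
          (fs := fun β => (F β).2.1) (Ps := fun β => (F β).2.2) (hMs.1.mono hα.le)
          (hMs.1.2 α hα hl) hinc hU (fun β hβ => (hF β hβ).2.2.1) (fun β hβ => (hF β hβ).2.2.2.1)
          fun β γ hβγ hγ => ((hF γ hγ).2.2.2.2.2.1 β hβγ).2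
        have hPc : K.MemCard lam P := (hMsc α hα).iso hf
        have hPl := (hK.union α _ P trivial hl hPinc hPU).2
        refine ⟨(U, f, P), fun h => absurd h hl.ne_bot, hUc, hf, hPle, ?_,
          fun β hβ => ⟨hUle β hβ, hff β hβ⟩, fun _ => hU⟩
        let Ps : Ordinal.{u} → SetModel L := fun β => if β < α then (F β).2.2 else P
        let Ns : Ordinal.{u} → SetModel L := fun β => if β < α then (F β).1 else U
        have hPs : ∀ β < α, (F β).2.2 = Ps β := fun β hβ => by simp [Ps, hβ]
        have hNs : ∀ β < α, (F β).1 = Ns β := fun β hβ => by simp [Ns, hβ]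
        have hPα : Ps α = P := by simp [Ps]
        have hNα : Ns α = U := by simp [Ns]
        have h := hlim α Ps Ns hα hl
          ((hPinc.congr hPs).succ (hPα ▸ hPc.1) (fun β hβ => hPα ▸ hPs β hβ ▸ hPl β hβ)
            fun _ => hPα ▸ hPU.congr hPs)
          ((hinc.congr hNs).succ (hNα ▸ hUm) (fun β hβ => hNα ▸ hNs β hβ ▸ hUle β hβ)
            fun _ => hNα ▸ hU.congr hNs)
          (fun β hβ => by
            rcases hβ.eq_or_lt with rfl | hβ
            · rw [hPα, hNα]
              exact ⟨hPc, hUc, hPle⟩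
            · rw [← hPs β hβ, ← hNs β hβ]
              exact ⟨(hMsc β (hβ.trans hα)).iso (hF β hβ).2.2.1, (hF β hβ).2.1,
                (hF β hβ).2.2.2.1⟩)
          (by rw [← hPs 0 hα0, (hF 0 hα0).1 rfl]) (by rw [← hNs 0 hα0, (hF 0 hα0).1 rfl])
          (fun β hβ => by
            rw [← hPs β hβ, ← hNs β hβ]
            exact (hF β hβ).2.2.2.2.1)
        rwa [hPα, hNα] at h)
  have hinc : K.IsIncCont (Order.succ lam).ord fun β => (F β).1 := by
    refine ⟨fun β γ hβγ hγ => ?_, fun γ hγ hl => (hF γ hγ).2.2.2.2.2.2 hl⟩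
    rcases hβγ.eq_or_lt with rfl | hβγ
    · exact K.le_refl (hF _ hγ).2.1.1
    · exact ((hF γ hγ).2.2.2.2.2.1 β hβγ).1
  obtain ⟨U, hU, hUm, hUle⟩ := hK.exists_isUnion hθ hinc
  obtain ⟨f, P, hf, hff, -, -, hPle⟩ := hK.exists_limit_iso hθ
    (fs := fun β => (F β).2.1) (Ps := fun β => (F β).2.2) hMs.1 hMs.2.2 hinc hU
    (fun β hβ => (hF β hβ).2.2.1) (fun β hβ => (hF β hβ).2.2.2.1)
    fun β γ hβγ hγ => ((hF γ hγ).2.2.2.2.2.1 β hβγ).2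
  have hF0 := (hF 0 hθ0).1 rfl
  refine ⟨f, P, U, hf, hPle, ⟨hUm, le_antisymm ?_ ?_⟩, fun x hx => ?_, ?_, fun α hα => ?_⟩
  · exact hU.card_le (h0.trans (Order.le_succ lam)) (Cardinal.card_ord _).le
      fun α hα => (hF α hα).2.1.2.le.trans (Order.le_succ lam)
  · exact (hM.iso hf).2.ge.trans (card_le_of_subset (subset_of_le hPle))
  · rw [hff 0 hθ0 x hx, hF0]
    rfl
  · have := hUle 0 hθ0
    rwa [hF0] at this
  · exact ⟨(F α).2.2, (F α).1, (hF α hα).2.2.1.congr fun x hx => (hff α hα x hx).symm,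
      (hF α hα).2.2.2.1, hUle α hα, (hF α hα).2.2.2.2.1⟩

end AbstractClass

namespace PreFrame

open AbstractClass

namespace IsSemiGoodFrame

set_option linter.unusedSectionVars false

variable {L : FirstOrder.Language.{u, u}} {s : PreFrame L} {lam : Cardinal.{u}}
  {M N P B C M₀ M₁ M₂ M₃ : SetModel L} {a a₁ a₂ : ZFSet.{u}} {f : ZFSet.{u} → ZFSet.{u}}

variable (hs : s.IsSemiGoodFrame lam) (h0 : ℵ₀ ≤ lam)
include hs h0

/-! ### Extending models of cardinality `λ⁺` -/

/-- A model of cardinality `λ⁺` and one of cardinality `λ` can be amalgamated over a model of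
cardinality `λ`. -/
theorem exists_amalgam_succ (hM : s.K.MemCard (Order.succ lam) M) (hB : s.K.MemCard lam B)
    (hC : s.K.MemCard lam C) (hBM : s.K.le B M) (hBC : s.K.le B C) :
    ∃ N g, s.K.MemCard (Order.succ lam) N ∧ s.K.le M N ∧ s.K.IsEmbOver B g C N := by
  obtain ⟨Ms, hMs, rfl⟩ := hs.lst.exists_filtration hs.isAEC h0 hM hB hBM
  obtain ⟨f, M', N, hf, hM'N, hN, hfix, hCN, -⟩ := hs.isAEC.exists_direct_limit h0 hM hMs hC hBC
    (fun _ _ => True) trivial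
    (fun P N P' hP hN hP' hPN hPP' _ _ => by
      obtain ⟨N', g, hN', hle, ⟨P'', hP'', hle'⟩, hg⟩ :=
        hs.amalgamation.exists_le hP hP' hN hPP' hPN
      exact ⟨N', g, P'', hN', hle, hP'', hg, hle', trivial⟩)
    (fun _ _ _ _ _ _ _ _ _ _ _ => trivial)
  obtain ⟨g, N', hg, hle, hgf⟩ := IsEmb.exists_extend (K := s.K) ⟨M', hf, hM'N⟩
  refine ⟨N', g, hN.iso hg, hle, (IsEmb.of_le hCN).comp_iso hg, fun x hx => ?_⟩
  have := hgf x (subset_of_le hBM hx)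
  rwa [hfix x hx] at this

/-- A non-forking relation is prolonged along an extension `P'` of `P`, after embedding `P'`. -/
theorem exists_nf_step (hN : s.K.MemCard lam N) {P' : SetModel L} (hP' : s.K.MemCard lam P')
    (hPP' : s.K.le P P') (hn : s.nf B a P N) :
    ∃ N' h P'', s.K.MemCard lam N' ∧ s.K.le N N' ∧ IsIso h P' P'' ∧ (∀ x ∈ P.carrier, h x = x) ∧
      s.K.le P'' N' ∧ s.nf B a P'' N' := by
  obtain ⟨hB, hP, -, hBP, hPN, ha, ha', hb, -⟩ := hs.frame.nfBasic _ _ _ _ hn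
  obtain ⟨q, -, ⟨t, rfl, ht⟩, hq⟩ := hs.frame.extension P P' hPP' hP hP' _ hb
  obtain ⟨-, -, htop, -⟩ := hs.frame.nfBasic _ _ _ _ ht
  obtain ⟨N', g, hN', hle, ⟨⟨T, hT, hTN'⟩, hg⟩, hga⟩ := exists_amalgam_of_mk_eq hs.amalgamation
    hs.lst hs.isAEC h0 hP (t₁ := ⟨t.top, t.elt, s.K.le_trans hPP' t.le_top, t.elt_mem,
      fun h => t.elt_notMem (subset_of_le hPP' h)⟩) (t₂ := ⟨N, a, hPN, ha, ha'⟩) hq htop hN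
  obtain ⟨P'', hP'', hP''T⟩ := exists_le_of_isIso t.le_top hT
  have h1 := nfGE_iso hs h0 (nfGE_of_nf hs h0 ht) (IsIso.of_fixed hg) hP'' hT
  have h2 := nfGE_top hs h0 h1 hTN'
  rw [hga] at h2
  have h3 := nfGE_trans hs h0 hB hP (nfGE_top hs h0 (nfGE_of_nf hs h0 hn) hle) h2
  exact ⟨N', g, P'', hN', hle, hP'', hg, s.K.le_trans hP''T hTN',
    (nfGE_iff_nf hs h0 hB (hP'.iso hP'') hN').1 h3⟩

/-- Continuity of non-forking in cardinality `lam`, for a fixed element. -/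
theorem nf_of_isSuccLimit {δ : Ordinal.{u}} {Ps : Ordinal.{u} → SetModel L}
    (hδ : δ < (Order.succ lam).ord) (hl : Order.IsSuccLimit δ) (hinc : s.K.IsIncCont (δ + 1) Ps)
    (hPs : ∀ α ≤ δ, s.K.MemCard lam (Ps α)) (hN : s.K.MemCard lam N) (hle : s.K.le (Ps δ) N)
    (hn : ∀ α < δ, s.nfGE lam (Ps 0) a (Ps α) N) : s.nf (Ps 0) a (Ps δ) N := by
  have hδ1 : δ < δ + 1 := Order.lt_add_one_iff.2 le_rfl
  have hn0 := hn 0 (pos_iff_ne_zero.2 hl.ne_bot)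
  have ha' : a ∉ (Ps δ).carrier := fun h => by
    obtain ⟨α, hα, h⟩ := ((hinc.2 δ hδ1 hl).2 a).1 h
    exact (hn α hα).notMem h
  refine (doesNotFork_tp_iff hs h0 hle hn0.mem ha' hN).1
    (hs.frame.continuity δ Ps hδ hl hinc (fun α hα => (hPs α hα).2) _ fun α hα => ?_).2
  have hα' := hinc.1 α δ hα.le hδ1
  exact ⟨hα', ⟨N, a, s.K.le_trans hα' hle, hn0.mem, (hn α hα).notMem⟩, rfl,
    (nfGE_iff_nf hs h0 (hPs 0 zero_le) (hPs α hα.le) hN).1 (hn α hα)⟩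

/-- A basic type over a model of cardinality `λ` has a non-forking extension over each model of
cardinality `λ⁺`. -/
theorem exists_nfGE_extension (hM : s.K.MemCard (Order.succ lam) M) (hB : s.K.MemCard lam B)
    (hBM : s.K.le B M) (hC : s.K.MemCard lam C) (hBC : s.K.le B C) (ha : a ∈ C.carrier)
    (ha' : a ∉ B.carrier) (hb : tp hBC ha ha' ∈ s.bs B) :
    ∃ (N : SetModel L) (b : ZFSet.{u}) (h : s.K.le M N) (hbN : b ∈ N.carrier)
      (hbB : b ∉ B.carrier), s.K.MemCard (Order.succ lam) N ∧ s.nfGE lam B b M N ∧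
        tp (s.K.le_trans hBM h) hbN hbB = tp hBC ha ha' := by
  obtain ⟨Ms, hMs, rfl⟩ := hs.lst.exists_filtration hs.isAEC h0 hM hB hBM
  obtain ⟨f, M', N, hf, hM'N, hN, hfix, hCN, H⟩ := hs.isAEC.exists_direct_limit h0 hM hMs hC hBC
    (fun P N => s.nf (Ms 0) a P N) (nf_self hs h0 hB hC hBC ha ha' hb)
    (fun P N P' _ hN hP' _ hPP' _ hn => exists_nf_step hs h0 hN hP' hPP' hn)
    (fun δ Ps Ns hδ hl hPs hNs hc hP0 hN0 hn => by
      rw [← hP0] at hn ⊢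
      exact nf_of_isSuccLimit hs h0 hδ hl hPs (fun α hα => (hc α hα).1) (hc δ le_rfl).2.1
        (hc δ le_rfl).2.2 fun α hα => nfGE_top hs h0 (nfGE_of_nf hs h0 (hn α hα))
          (hNs.1 α δ hα.le (Order.lt_add_one_iff.2 le_rfl)))
  have hBM' : s.K.le (Ms 0) M' := s.K.le_iso hBM hf (IsIso.of_fixed hfix)
  have hα : ∀ R, s.K.MemCard lam R → s.K.le (Ms 0) R → s.K.le R M' →
      s.nfGE lam (Ms 0) a R N := by
    intro R hR hBR hRM
    obtain ⟨g, hg, hgf, hfg⟩ := hf.symm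
    obtain ⟨R', hR', hR'M⟩ := exists_le_of_isIso hRM hg
    obtain ⟨α, hα, hle⟩ := hMs.exists_le hs.isAEC h0 (hR.iso hR') hR'M
    obtain ⟨P, Nα, hP, hPN, hN, hn⟩ := H α hα
    have hPM' := s.K.le_iso (hMs.le hs.isAEC h0 α hα) hf hP
    refine nfGE_mid hs h0 (nfGE_top hs h0 (nfGE_of_nf hs h0 hn) hN) hBR
      (hs.isAEC.coherent.le_of_subset hRM hPM' fun x hx => ?_)
    rw [← hfg x (subset_of_le hRM hx)]
    exact hP.mem (subset_of_le hle (hR'.mem hx))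
  have ha'' : a ∉ M'.carrier := by
    intro h
    obtain ⟨R, hR, hBR, hRM, haR⟩ := exists_between_mem hs h0 le_rfl hBM' hB.2 h
    exact (hα R hR hBR hRM).notMem haR
  have hn : s.nfGE lam (Ms 0) a M' N :=
    nfGE_of_forall hs h0 hB hBM' hM'N (subset_of_le hCN ha) ha'' hα
  obtain ⟨g, N', hg, hle, hgf⟩ := IsEmb.exists_extend (K := s.K) ⟨M', hf, hM'N⟩
  have hgB : ∀ x ∈ (Ms 0).carrier, g x = x := fun x hx => by
    have := hgf x (subset_of_le hBM hx)
    rwa [hfix x hx] at this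
  have hn' := nfGE_iso hs h0 hn (IsIso.of_fixed hgB) (hf.symm_of_leftInv hgf) hg
  exact ⟨N', g a, hle, hn'.mem, fun h => hn'.notMem (subset_of_le hBM h), hN.iso hg, hn',
    (tp_eq_of_isEmbOver ⟨(IsEmb.of_le hCN).comp_iso hg, hgB⟩ _ _ _ _ _ _ rfl).symm⟩

theorem exists_small_le (hM : s.K.Mem M) (hc : lam ≤ M.card) {A : Set ZFSet.{u}}
    (hA : A ⊆ M.carrier) (hAc : #A ≤ Cardinal.lift.{u + 1} lam) :
    ∃ B, s.K.MemCard lam B ∧ s.K.le B M ∧ A ⊆ B.carrier :=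
  hs.lst.exists_le h0 le_rfl hM hc hA hAc

theorem exists_small (hM : s.K.Mem M) (hc : lam ≤ M.card) :
    ∃ B, s.K.MemCard lam B ∧ s.K.le B M := by
  obtain ⟨B, hB, hBM, -⟩ := exists_small_le hs h0 hM hc (Set.empty_subset _) (by simp)
  exact ⟨B, hB, hBM⟩

theorem noMaximal_succ : s.K.NoMaximal (Order.succ lam) := by
  intro M hM
  obtain ⟨B, hB, hBM⟩ := exists_small hs h0 hM.1 (hM.2.ge.trans' (Order.le_succ lam))
  obtain ⟨C, hC, hBC, hne⟩ := hs.frame.noMaximal B hB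
  obtain ⟨a, ha, ha', hb⟩ := hs.frame.density B C hBC hB hC hne
  obtain ⟨N, b, h, hb, -, hN, hn, -⟩ := exists_nfGE_extension hs h0 hM hB hBM hC hBC ha ha' hb
  exact ⟨N, hN, h, fun he => hn.notMem (he ▸ hb)⟩

/-! ### Density of basic types in `λ⁺` -/

/-- If all elements of `N` outside `M` forked over all small submodels of `M`, an `ω`-chain of
small models closed under witnesses for forking would contradict density and local character in
cardinality `λ`. -/
theorem exists_nfGE_of_ne (hM : s.K.MemCard (Order.succ lam) M) (hMN : s.K.le M N)
    (hne : M.carrier ≠ N.carrier) : ∃ a B, s.K.MemCard lam B ∧ s.nfGE lam B a M N := by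
  classical
  by_contra! hcon
  have hlM : lam ≤ M.card := (Order.le_succ lam).trans hM.2.ge
  have hlN : lam ≤ N.card := hlM.trans (card_le_of_subset (subset_of_le hMN))
  obtain ⟨b, hbN, hbM⟩ : ∃ b ∈ N.carrier, b ∉ M.carrier := by
    by_contra! h
    exact hne ((subset_of_le hMN).antisymm h)
  have hlift : ℵ₀ ≤ Cardinal.lift.{u + 1} lam := Cardinal.aleph0_le_lift.2 h0
  -- `W A a` witnesses that `a` forks over `A`.
  have hW : ∀ A a, ∃ W, s.K.MemCard lam A → s.K.le A M → a ∈ N.carrier → a ∉ M.carrier →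
      s.K.MemCard lam W ∧ s.K.le A W ∧ s.K.le W M ∧ ¬ s.nfGE lam A a W N := by
    intro A a
    by_contra! h
    obtain ⟨hA, hAM, ha, ha', -⟩ := h A
    exact hcon a A hA (nfGE_of_forall hs h0 hA hAM hMN ha ha' fun R hR hAR hRM =>
      (h R).2.2.2.2 hR hAR hRM)
  choose W hW using hW
  -- `C A` is a small submodel of `M` that contains `A ∩ M`.
  have hC : ∀ A, ∃ C, s.K.MemCard lam A → s.K.MemCard lam C ∧ s.K.le C M ∧
      A.carrier ∩ M.carrier ⊆ C.carrier := by
    intro A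
    by_cases hA : s.K.MemCard lam A
    · obtain ⟨C, hC, h1, h2⟩ := exists_small_le hs h0 hM.1 hlM (A := A.carrier ∩ M.carrier)
        Set.inter_subset_right
        ((Cardinal.mk_le_mk_of_subset Set.inter_subset_left).trans (mk_carrier_le hA le_rfl))
      exact ⟨C, fun _ => ⟨hC, h1, h2⟩⟩
    · exact ⟨M, fun h => absurd h hA⟩
  choose C hC using hC
  -- `D A` collects the witnesses for the elements of `A` outside `M`.
  let D : SetModel L → Set ZFSet.{u} := fun A =>
    ⋃ a : (A.carrier \ M.carrier : Set ZFSet.{u}), (W (C A) a).carrier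
  have hD : ∀ A, s.K.MemCard lam A → s.K.le A N →
      D A ⊆ M.carrier ∧ #(D A) ≤ Cardinal.lift.{u + 1} lam := by
    intro A hA hAN
    have h := fun a : (A.carrier \ M.carrier : Set ZFSet.{u}) =>
      hW (C A) a (hC A hA).1 (hC A hA).2.1 (subset_of_le hAN a.2.1) a.2.2
    refine ⟨Set.iUnion_subset fun a => subset_of_le (h a).2.2.1, ?_⟩
    refine (Cardinal.mk_iUnion_le _).trans ((mul_le_mul' ?_ (ciSup_le' fun a => ?_)).trans
      (Cardinal.mul_eq_self hlift).le)
    · exact (Cardinal.mk_le_mk_of_subset Set.sdiff_subset).trans (mk_carrier_le hA le_rfl)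
    · exact mk_carrier_le (h a).1 le_rfl
  have hω : Ordinal.omega0.{u} < (Order.succ lam).ord := by
    rw [← Cardinal.ord_aleph0]
    exact Cardinal.ord_lt_ord.2 (h0.trans_lt (Order.lt_succ lam))
  have hωl : Order.IsSuccLimit Ordinal.omega0.{u} := Ordinal.isSuccLimit_omega0
  have hω1 : Ordinal.omega0.{u} < Ordinal.omega0.{u} + 1 := Order.lt_add_one_iff.2 le_rfl
  obtain ⟨B, hB, hBN, hbB⟩ := exists_small_le hs h0 (s.K.mem_of_le hMN).2 hlN (A := {b})
    (Set.singleton_subset_iff.2 hbN)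
    (by rw [Cardinal.mk_singleton]; exact Cardinal.one_le_aleph0.trans hlift)
  obtain ⟨A, hA0, hA, hAN, hAΦ⟩ := hs.lst.exists_chain hs.isAEC h0 (θ := Ordinal.omega0.{u} + 1)
    ((isSuccLimit_succ_ord h0).add_one_lt hω).le (fun _ => N)
    (fun _ _ _ _ => s.K.le_refl (s.K.mem_of_le hMN).2) (fun _ A => (C A).carrier ∪ D A)
    (fun _ A _ hA hAN => ⟨(Set.union_subset (subset_of_le (hC A hA).2.1) (hD A hA hAN).1).trans
      (subset_of_le hMN), (Cardinal.mk_union_le _ _).trans (Cardinal.add_le_of_le hlift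
        (mk_carrier_le (hC A hA).1 le_rfl) (hD A hA hAN).2)⟩) hB hBN
  have hAc : ∀ i ≤ Ordinal.omega0.{u}, s.K.MemCard lam (A i) ∧ s.K.le (A i) N :=
    fun i hi => hAN i (Order.lt_add_one_iff.2 hi)
  have hAle : ∀ i j, i ≤ j → j ≤ Ordinal.omega0.{u} → (A i).carrier ⊆ (A j).carrier :=
    fun i j hij hj => subset_of_le (hA.1 i j hij (Order.lt_add_one_iff.2 hj))
  -- The models `Cs i` increase since `A i ∩ M ⊆ Cs i ⊆ A (i + 1) ∩ M`; their union `U`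
  -- is `A ω ∩ M`.
  let Cs : Ordinal.{u} → SetModel L := fun i => C (A i)
  have hCs : ∀ i < Ordinal.omega0.{u}, s.K.MemCard lam (Cs i) ∧ s.K.le (Cs i) M ∧
      (A i).carrier ∩ M.carrier ⊆ (Cs i).carrier := fun i hi => hC _ (hAc i hi.le).1
  have hΦ : ∀ i < Ordinal.omega0.{u}, (Cs i).carrier ∪ D (A i) ⊆ (A (i + 1)).carrier :=
    fun i hi => hAΦ i ((hωl.add_one_lt hi).trans hω1)
  have hinc : s.K.IsIncCont Ordinal.omega0.{u} Cs := by
    refine ⟨fun i j hij hj => ?_, fun γ hγ hl => absurd (Ordinal.omega0_le_of_isSuccLimit hl)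
      hγ.not_ge⟩
    rcases hij.eq_or_lt with rfl | hij
    · exact s.K.le_refl (hCs i hj).1.1
    · have hi := hij.trans hj
      refine hs.isAEC.coherent.le_of_subset (hCs i hi).2.1 (hCs j hj).2.1 fun x hx =>
        (hCs j hj).2.2 ⟨?_, subset_of_le (hCs i hi).2.1 hx⟩
      exact hAle _ _ (Order.add_one_le_of_lt hij) hj.le (hΦ i hi (Or.inl hx))
  obtain ⟨U, hU, hUm, hUle⟩ := hs.isAEC.exists_isUnion hωl hinc
  have hUc : s.K.MemCard lam U := ⟨hUm, card_eq_of_isUnion hωl h0 (card_le_of_lt_succ_ord hω)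
    (fun i hi => (hCs i hi).1.2) hU⟩
  have hUM : s.K.le U M := hs.isAEC.smooth _ Cs U M trivial hωl hinc hU fun i hi => (hCs i hi).2.1
  have hUA : s.K.le U (A Ordinal.omega0) := by
    refine hs.isAEC.coherent.le_of_subset (s.K.le_trans hUM hMN) (hAc _ le_rfl).2 fun x hx => ?_
    obtain ⟨i, hi, hx⟩ := (hU.2 x).1 hx
    exact hAle _ _ (hωl.add_one_lt hi).le le_rfl (hΦ i hi (Or.inl hx))
  have hbA : b ∈ (A Ordinal.omega0).carrier :=
    hAle 0 _ zero_le le_rfl (hA0 ▸ hbB rfl)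
  obtain ⟨a, ha, ha', hb⟩ := hs.frame.density U _ hUA hUc (hAc _ le_rfl).1
    fun he => hbM (subset_of_le hUM (he ▸ hbA))
  obtain ⟨j, hj, haj⟩ := ((hA.2 _ hω1 hωl).2 a).1 ha
  have haM : a ∉ M.carrier := fun h => ha' ((hU.2 a).2 ⟨j, hj, (hCs j hj).2.2 ⟨haj, h⟩⟩)
  let Ns : Ordinal.{u} → SetModel L := fun i => if i < Ordinal.omega0 then Cs i else U
  have hNs : ∀ i < Ordinal.omega0.{u}, Cs i = Ns i := fun i hi => by simp [Ns, hi]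
  have hNω : Ns Ordinal.omega0 = U := by simp [Ns]
  have hnU : s.nf (Ns Ordinal.omega0) a (Ns Ordinal.omega0) (A Ordinal.omega0) := by
    rw [hNω]
    exact nf_self hs h0 hUc (hAc _ le_rfl).1 hUA ha ha' hb
  obtain ⟨-, -, -, -, hUA', haA, haU, hb', -⟩ := hs.frame.nfBasic _ _ _ _ hnU
  obtain ⟨i, hi, hn⟩ := hs.frame.localCharacter Ordinal.omega0 Ns hω hωl
    ((hinc.congr hNs).succ (hNω ▸ hUm) (fun i hi => hNω ▸ hNs i hi ▸ hUle i hi)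
      fun _ => hNω ▸ hU.congr hNs)
    (fun i hi => by
      rcases hi.eq_or_lt with rfl | hi
      · rw [hNω]; exact hUc.2
      · rw [← hNs i hi]; exact (hCs i hi).1.2)
    _ hb'
  have hn₁ := nfGE_of_nf hs h0 ((doesNotFork_tp_iff hs h0 hUA' haA haU (hAc _ le_rfl).1).1 hn)
  rw [← hNs i hi, hNω] at hn₁
  have hm := max_lt hi hj
  -- The element `a` is free from `U` over `Cs (max i j)`, but `U` contains the witness that `a`
  -- forks over this model.
  have ham : a ∈ (A (max i j)).carrier := hAle _ _ (le_max_right i j) hm.le haj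
  obtain ⟨-, hCW, hWM, hfork⟩ := hW (Cs (max i j)) a (hCs _ hm).1 (hCs _ hm).2.1
    (subset_of_le (hAc _ le_rfl).2 ha) haM
  refine hfork (nfGE_mid hs h0 (nfGE_top hs h0 (nfGE_base hs h0 hn₁
    (hinc.1 _ _ (le_max_left i j) hm) (hUle _ hm)) (hAc _ le_rfl).2) hCW
      (hs.isAEC.coherent.le_of_subset hWM hUM fun x hx => ?_))
  refine (hU.2 x).2 ⟨_, hωl.add_one_lt hm, (hCs _ (hωl.add_one_lt hm)).2.2
    ⟨hΦ _ hm (Or.inr ?_), subset_of_le hWM hx⟩⟩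
  exact Set.mem_iUnion.2 ⟨⟨a, ham, haM⟩, hx⟩

/-! ### Local character and continuity in `λ⁺` -/

/-- Local character of `nfGE` along a chain of models of cardinality at least `λ`. -/
theorem exists_nfGE_of_isSuccLimit {δ : Ordinal.{u}} {Ms : Ordinal.{u} → SetModel L}
    (hδ : Order.IsSuccLimit δ) (hM : s.K.IsIncCont (δ + 1) Ms) (hc : lam ≤ (Ms 0).card)
    (hB : s.K.MemCard lam B) (hn : s.nfGE lam B a (Ms δ) N) :
    ∃ α < δ, s.nfGE lam (Ms α) a (Ms δ) N := by
  have hδ1 : δ < δ + 1 := Order.lt_add_one_iff.2 le_rfl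
  have hle : ∀ α < δ, s.K.le (Ms α) (Ms δ) := fun α hα => hM.1 α δ hα.le hδ1
  obtain ⟨B₀, hB₀, hB₀M⟩ := exists_small hs h0
    (s.K.mem_of_le (hle 0 (pos_iff_ne_zero.2 hδ.ne_bot))).1 hc
  rcases hs.lst.exists_reflection hs.isAEC h0 hδ hM hB hn.le₀₁ hB₀ hB₀M with
    ⟨α, hα, hBα⟩ | ⟨κ, Ns, hκ, hκl, hNs, -, hNc, hNM, hNδ, hBN⟩
  · exact ⟨α, hα, nfGE_base hs h0 hn hBα (hle α hα)⟩
  · have hn₁ := nfGE_base hs h0 hn hBN hNδ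
    obtain ⟨R, hR, hNR, hRN, haR⟩ := exists_between_mem hs h0 le_rfl (s.K.le_trans hNδ hn.le₁₂)
      (hNc κ le_rfl).2 hn.mem
    have hnf := (nfGE_iff_nf hs h0 hB (hNc κ le_rfl) hR).1
      (nfGE_of_top hs h0 (nfGE_mid hs h0 hn hBN hNδ) hNR hRN haR)
    obtain ⟨-, -, -, -, h₁, ha, ha', hb, -⟩ := hs.frame.nfBasic _ _ _ _ hnf
    obtain ⟨i, hi, hdnf⟩ := hs.frame.localCharacter κ Ns hκ hκl hNs (fun i hi => (hNc i hi).2) _ hb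
    have hni := nfGE_of_nf hs h0 ((doesNotFork_tp_iff hs h0 h₁ ha ha' hR).1 hdnf)
    obtain ⟨α, hα, hiα⟩ := hNM i hi
    exact ⟨α, hα, nfGE_base hs h0 (nfGE_trans hs h0 (hNc i hi.le) (hNc κ le_rfl)
      (nfGE_top hs h0 hni hRN) hn₁) hiα (hle α hα)⟩

/-- Continuity of `nfGE` along a chain of models: a base of cardinality `λ` for non-forking over the
first member serves for all members, and hence for their union. -/
theorem nfGE_continuity {δ : Ordinal.{u}} {Ms : Ordinal.{u} → SetModel L}
    (hδ : Order.IsSuccLimit δ) (hM : s.K.IsIncCont (δ + 1) Ms) (hN : s.K.le (Ms δ) N)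
    (hn : ∀ α < δ, s.nfGE lam (Ms 0) a (Ms α) N) :
    ∃ B, s.K.MemCard lam B ∧ s.K.le B (Ms 0) ∧ s.nfGE lam B a (Ms δ) N := by
  have hδ1 : δ < δ + 1 := Order.lt_add_one_iff.2 le_rfl
  have hδ0 : 0 < δ := pos_iff_ne_zero.2 hδ.ne_bot
  have hle : ∀ α < δ, s.K.le (Ms α) (Ms δ) := fun α hα => hM.1 α δ hα.le hδ1
  obtain ⟨B, hB, hB0, hnB⟩ := (hn 0 hδ0).exists_base
  have hn' : ∀ α < δ, s.nfGE lam B a (Ms α) N := fun α hα =>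
    nfGE_trans_base hs h0 hB hnB (hn α hα)
  have ha' : a ∉ (Ms δ).carrier := fun h => by
    obtain ⟨α, hα, h⟩ := ((hM.2 δ hδ1 hδ).2 a).1 h
    exact (hn α hα).notMem h
  refine ⟨B, hB, hB0, nfGE_of_forall hs h0 hB (s.K.le_trans hB0 (hle 0 hδ0)) hN hnB.mem ha'
    fun R hR hBR hRM => ?_⟩
  rcases hs.lst.exists_reflection hs.isAEC h0 hδ hM hR hRM hB hB0 with
    ⟨α, hα, hRα⟩ | ⟨κ, Ns, hκ, hκl, hNs, rfl, hNc, hNM, hNδ, hRN⟩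
  · exact nfGE_mid hs h0 (hn' α hα) hBR hRα
  · obtain ⟨Q, hQ, hNQ, hQN, haQ⟩ := exists_between_mem hs h0 le_rfl (s.K.le_trans hNδ hN)
      (hNc κ le_rfl).2 hnB.mem
    have := nf_of_isSuccLimit (a := a) hs h0 hκ hκl hNs hNc hQ hNQ fun i hi => by
      obtain ⟨α, hα, hiα⟩ := hNM i hi
      have hiκ := hNs.1 i κ hi.le (Order.lt_add_one_iff.2 le_rfl)
      exact nfGE_of_top hs h0 (nfGE_mid hs h0 (hn' α hα)
        (hNs.1 0 i zero_le (Order.lt_add_one_iff.2 hi.le)) hiα) (s.K.le_trans hiκ hNQ) hQN haQ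
    exact nfGE_mid hs h0 (nfGE_top hs h0 (nfGE_of_nf hs h0 this) hQN) hBR hRN

/-! ### Symmetry in `λ⁺` -/

/-- Symmetry in cardinality `λ` makes `⟨a₂, a₁⟩` independent over each small model. -/
theorem indepIn_two (hM₃ : s.K.MemCard (Order.succ lam) M₃) (hB : s.K.MemCard lam B)
    (h₁₃ : s.K.le M₁ M₃) (ha : a₁ ∈ M₁.carrier)
    (hn₁ : s.nfGE lam B a₁ B M₃) (hn₂ : s.nfGE lam B a₂ M₁ M₃) :
    s.IndepIn lam 2 (fun i => if i = 0 then a₂ else a₁) B B M₃ := by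
  obtain ⟨P, hP, hBP, hPM, haP⟩ := exists_between_mem hs h0 le_rfl hn₂.le₀₁ hB.2 ha
  obtain ⟨Q, hQ, hPQ, hQM, haQ⟩ := exists_between_mem hs h0 le_rfl (s.K.le_trans hPM h₁₃) hP.2
    hn₂.mem
  have hn₂' := nfGE_of_top hs h0 (nfGE_mid hs h0 hn₂ hBP hPM) hPQ hQM haQ
  have hn₁' := nfGE_of_top hs h0 hn₁ (s.K.le_trans hBP hPQ) hQM (subset_of_le hPQ haP)
  obtain ⟨-, -, -, -, hBQ, ha₁, ha₁', hb, -⟩ :=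
    hs.frame.nfBasic _ _ _ _ ((nfGE_iff_nf hs h0 hB hB hQ).1 hn₁')
  obtain ⟨M₂, M₃', hM₂, hM₃', hBM₂, hM₂₃, hQM₃, ha₂, hn⟩ := hs.frame.symmetry B P Q a₁ a₂ hBP hPQ
    haP ha₁' hB hP hQ hb ((nfGE_iff_nf hs h0 hB hP hQ).1 hn₂')
  obtain ⟨N, g, hN, hMN, ⟨T, hT, hTN⟩, hg⟩ := exists_amalgam_succ hs h0 hM₃ hQ hM₃' hQM hQM₃
  obtain ⟨S, hS, hST⟩ := exists_le_of_isIso hM₂₃ hT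
  have hgB : ∀ x ∈ B.carrier, g x = x := fun x hx => hg x (subset_of_le hBQ hx)
  have hnT := nfGE_iso hs h0 (nfGE_of_nf hs h0 hn) (IsIso.of_fixed hgB) hS hT
  rw [hg _ ha₁] at hnT
  have hnS := nfGE_iso hs h0 (nfGE_of_top hs h0 (nfGE_top hs h0 (nfGE_mid hs h0 hn₂'
    (s.K.le_refl hB.1) hBP) hQM₃) hBM₂ hM₂₃ ha₂) (IsIso.of_fixed hgB) (IsIso.of_fixed hgB) hS
  rw [hg _ haQ] at hnS
  have hBM := hn₁.le₁₂
  -- The images `S`, `T` of `M₂`, `M₃'` in a common extension of `M₃` and `M₃'` over `Q` witness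
  -- independence.
  let Ns : Ordinal.{u} → SetModel L := fun i => if i = 0 then B else if i = 1 then S else T
  have e0 : Ns 0 = B := by simp [Ns]
  have e1 : Ns 1 = S := by simp [Ns]
  have e2 : Ns 2 = T := by simp [Ns]
  have h1 : ¬ Order.IsSuccLimit (1 : Ordinal.{u}) := zero_add (1 : Ordinal.{u}) ▸
    not_isSuccLimit_add_one 0
  have h2 : ¬ Order.IsSuccLimit (2 : Ordinal.{u}) := one_add_one_eq_two (R := Ordinal.{u}) ▸
    not_isSuccLimit_add_one 1
  have lt1 : ∀ i : Ordinal.{u}, i < 1 → i = 0 := fun i hi => Order.lt_one_iff.1 hi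
  have lt2 : ∀ i : Ordinal.{u}, i < 2 → i = 0 ∨ i = 1 := fun i hi => by
    rw [← one_add_one_eq_two, Order.lt_add_one_iff] at hi
    rcases hi.eq_or_lt with h | h
    · exact Or.inr h
    · exact Or.inl (lt1 i h)
  have i1 : s.K.IsIncCont 1 Ns := by
    have : s.K.IsIncCont 0 Ns :=
      ⟨fun _ _ _ h => absurd h not_lt_zero, fun _ h => absurd h not_lt_zero⟩
    have := this.succ (e0 ▸ hB.1) (fun _ h => absurd h not_lt_zero)
      fun hl => absurd rfl hl.ne_bot
    rwa [zero_add] at this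
  have i2 : s.K.IsIncCont 2 Ns := by
    have := i1.succ (e1 ▸ (s.K.mem_of_le hST).1)
      (fun i hi => by rw [lt1 i hi, e0, e1]; exact hnT.le₀₁) fun hl => absurd hl h1
    rwa [one_add_one_eq_two] at this
  have i3 : s.K.IsIncCont (2 + 1) Ns := i2.succ (e2 ▸ (s.K.mem_of_le hST).2)
    (fun i hi => by
      rcases lt2 i hi with rfl | rfl
      · rw [e0, e2]; exact s.K.le_trans hnT.le₀₁ hST
      · rw [e1, e2]; exact hST) fun hl => absurd hl h2
  have key : ∀ X Y c, s.nfGE lam B c X Y → ∃ (h : s.K.le X Y) (hc : c ∈ Y.carrier)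
      (hc' : c ∉ X.carrier), s.DoesNotForkGE lam (tp h hc hc') B := fun X Y c h =>
    ⟨h.le₁₂, h.mem, h.notMem, (doesNotForkGE_tp_iff hs h0 _ _ _).2 h⟩
  refine ⟨s.K.le_refl hB.1, hBM, fun i hi => ?_, Ns, N, e0, ⟨i3, e0.symm ▸ s.K.le_refl hB.1,
    fun i hi => ?_⟩, hMN, e2 ▸ hTN⟩
  · rcases lt2 i hi with rfl | rfl
    · simpa using ⟨hn₂.mem, hnS.notMem⟩
    · simpa using ⟨hn₁.mem, hn₁.notMem⟩
  · rcases lt2 i hi with rfl | rfl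
    · exact key _ _ _ (by rw [zero_add, e0, e1]; simpa using hnS)
    · exact key _ _ _ (by rw [one_add_one_eq_two, e2, e1]; simpa using hnT)

/-- Symmetry in `λ⁺`: the elements `a₂`, `a₁` are independent over each member of a filtration of
`M₀`, hence over `M₀`, and the models witnessing this are cut down to cardinality `λ⁺`. -/
theorem nfGE_symmetry (hcont : s.ContinuityOfIndependence lam 2)
    (hM₀ : s.K.MemCard (Order.succ lam) M₀) (hM₃ : s.K.MemCard (Order.succ lam) M₃)
    (h₁₃ : s.K.le M₁ M₃) (ha : a₁ ∈ M₁.carrier) (hB : s.K.MemCard lam B)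
    (hn₁ : s.nfGE lam B a₁ M₀ M₃) (hn₂ : s.nfGE lam M₀ a₂ M₁ M₃) :
    ∃ M₂ M₃', s.K.MemCard (Order.succ lam) M₂ ∧ s.K.MemCard (Order.succ lam) M₃' ∧
      s.K.le M₀ M₂ ∧ s.K.le M₂ M₃' ∧ s.K.le M₃ M₃' ∧ a₂ ∈ M₂.carrier ∧
      s.nfGE lam M₀ a₁ M₂ M₃' := by
  obtain ⟨B', hB', hB'0, hn₂'⟩ := hn₂.exists_base
  obtain ⟨D, hD, hBD, hB'D, hD0⟩ := exists_common hs h0 le_rfl hB hB' hn₁.le₀₁ hB'0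
  obtain ⟨Ms, hMs, hMsD⟩ := hs.lst.exists_filtration hs.isAEC h0 hM₀ hD hD0
  have hsucc : lam ≤ Order.succ lam := Order.le_succ lam
  have hind : s.IndepIn lam 2 (fun i => if i = 0 then a₂ else a₁) M₀ M₀ M₃ := by
    refine hcont M₀ M₃ Ms _ hM₀ hM₃ hn₁.le₁₂ hMs fun α hα => ?_
    have hα0 := hMs.le hs.isAEC h0 α hα
    have hDα : s.K.le D (Ms α) := hMsD ▸ hMs.1.1 0 α zero_le hα
    have h1 := s.K.le_trans hα0 hn₂.le₀₁
    exact indepIn_two hs h0 hM₃ (hMs.memCard hs.isAEC h0 hα) h₁₃ ha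
      (nfGE_base hs h0 (nfGE_mid hs h0 hn₁ (s.K.le_trans hBD hDα) hα0) (s.K.le_trans hBD hDα)
        (s.K.le_refl (s.K.mem_of_le hα0).1))
      (nfGE_base hs h0 hn₂' (s.K.le_trans hB'D hDα) h1)
  obtain ⟨-, -, -, Ns, N, rfl, ⟨hinc, -, hNs⟩, hM₃N, hNN⟩ := hind
  have h02 : (0 : Ordinal.{u}) < 2 := zero_lt_two
  have h12 : (1 : Ordinal.{u}) < 2 := one_lt_two
  obtain ⟨h01, ha₂, -, -⟩ := hNs 0 h02
  obtain ⟨h1, ha₁, ha₁', hdnf⟩ := hNs 1 h12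
  have hn := (doesNotForkGE_tp_iff hs h0 h1 ha₁ ha₁').1 hdnf
  simp only [zero_add, one_add_one_eq_two, one_ne_zero, if_true, if_false] at h01 ha₂ hn
  obtain ⟨M₂, hM₂, h0M₂, hM₂1, ha₂M⟩ := exists_between_mem hs h0 hsucc h01 hM₀.2 ha₂
  have hn' := nfGE_top hs h0 (nfGE_mid hs h0 hn h0M₂ hM₂1) hNN
  obtain ⟨M₃', hM₃', h3, h23, hN⟩ := exists_common hs h0 hsucc hM₃ hM₂ hM₃N hn'.le₁₂
  refine ⟨M₂, M₃', hM₂, hM₃', h0M₂, h23, h3, ha₂M, nfGE_of_top hs h0 hn' h23 hN ?_⟩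
  exact subset_of_le h3 (subset_of_le h₁₃ ha)

/-! ### The axioms of the derived frame -/

theorem isAECIn_succFrame : (s.succFrame lam).K.IsAECIn (Order.succ lam) where
  card_eq _ h := h.2
  union δ Ms U hδ hl hinc hU := by
    have hinc' : s.K.IsIncCont δ Ms := ⟨fun α β h h' => (hinc.1 α β h h').1, hinc.2⟩
    have hc : ∀ α < δ, (Ms α).card = Order.succ lam := fun α hα => (hinc.1 α α le_rfl hα).2.1
    have hUc := card_eq_of_isUnion hl (h0.trans (Order.le_succ lam)) (card_le_of_lt_succ_ord hδ)
      hc hU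
    obtain ⟨hm, hle⟩ := hs.isAEC.union δ Ms U trivial hl hinc' hU
    exact ⟨⟨hm, hUc⟩, fun α hα => ⟨hle α hα, hc α hα, hUc⟩⟩
  smooth δ Ms U N hδ hl hinc hU hN := by
    have hinc' : s.K.IsIncCont δ Ms := ⟨fun α β h h' => (hinc.1 α β h h').1, hinc.2⟩
    have hc : ∀ α < δ, (Ms α).card = Order.succ lam := fun α hα => (hinc.1 α α le_rfl hα).2.1
    exact ⟨hs.isAEC.smooth δ Ms U N trivial hl hinc' hU fun α hα => (hN α hα).1,
      card_eq_of_isUnion hl (h0.trans (Order.le_succ lam)) (card_le_of_lt_succ_ord hδ) hc hU,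
      (hN 0 (pos_iff_ne_zero.2 hl.ne_bot)).2.2⟩
  coherent M₀ M₁ N h h' hsub := ⟨hs.isAEC.coherent M₀ M₁ N h.1 h'.1 hsub, h.2.1, h'.2.1⟩

theorem tp_mem_bs_succFrame_iff (h : (s.succFrame lam).K.le M N) (ha : a ∈ N.carrier)
    (ha' : a ∉ M.carrier) : tp h ha ha' ∈ (s.succFrame lam).bs M ↔
      ∃ B, s.K.MemCard lam B ∧ s.nfGE lam B a M N := by
  constructor
  · rintro ⟨B, hB, -, hn⟩
    exact ⟨B, hB, (doesNotForkGE_tp_iff hs h0 h.1 ha ha').1 hn⟩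
  · rintro ⟨B, hB, hn⟩
    exact ⟨B, hB, hn.le₀₁, (doesNotForkGE_tp_iff hs h0 h.1 ha ha').2 hn⟩

theorem doesNotFork_succFrame_iff (h : (s.succFrame lam).K.le M N) (ha : a ∈ N.carrier)
    (ha' : a ∉ M.carrier) : (s.succFrame lam).DoesNotFork (tp h ha ha') M₀ ↔
      s.nfGE lam M₀ a M N ∧ M₀.card = Order.succ lam := by
  constructor
  · rintro ⟨t, ht, hn, hc, -⟩
    refine ⟨?_, hc⟩
    have := congrArg GType.ofAtCard ht
    exact nfGE_of_mk_eq hs h0 (t₁ := ⟨t.top, t.elt, t.le_top.1, t.elt_mem, t.elt_notMem⟩)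
      (t₂ := ⟨N, a, h.1, ha, ha'⟩) this hn
  · rintro ⟨hn, hc⟩
    exact ⟨⟨N, a, h, ha, ha'⟩, rfl, hn, hc, h.2.1, h.2.2⟩

theorem basicIso_succFrame : (s.succFrame lam).BasicIso (Order.succ lam) := by
  intro f a M N M' N' h ha ha' h' hb hb' _ _ hN hM hbs
  obtain ⟨B, hB, hn⟩ := (tp_mem_bs_succFrame_iff hs h0 h ha ha').1 hbs
  obtain ⟨B', hB', -⟩ := exists_le_of_isIso hn.le₀₁ hM
  exact (tp_mem_bs_succFrame_iff hs h0 h' hb hb').2 ⟨B', hB.iso hB', nfGE_iso hs h0 hn hB' hM hN⟩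

theorem density_succFrame : (s.succFrame lam).Density (Order.succ lam) := by
  intro M N h hM _ hne
  obtain ⟨a, B, hB, hn⟩ := exists_nfGE_of_ne hs h0 hM.1 h.1 hne
  exact ⟨a, hn.mem, hn.notMem, (tp_mem_bs_succFrame_iff hs h0 h _ _).2 ⟨B, hB, hn⟩⟩

theorem nfBasic_succFrame : (s.succFrame lam).NfBasic (Order.succ lam) := by
  rintro M₀ a M₁ M₃ ⟨hn, h₀, h₁, h₃⟩
  obtain ⟨B, hB, hB₀, hnB⟩ := hn.exists_base
  have m₀ : s.K.MemCard (Order.succ lam) M₀ := ⟨(s.K.mem_of_le hn.le₀₁).1, h₀⟩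
  have m₁ : s.K.MemCard (Order.succ lam) M₁ := ⟨(s.K.mem_of_le hn.le₀₁).2, h₁⟩
  have m₃ : s.K.MemCard (Order.succ lam) M₃ := ⟨(s.K.mem_of_le hn.le₁₂).2, h₃⟩
  have l₀₁ : (s.succFrame lam).K.le M₀ M₁ := ⟨hn.le₀₁, h₀, h₁⟩
  have l₁₃ : (s.succFrame lam).K.le M₁ M₃ := ⟨hn.le₁₂, h₁, h₃⟩
  refine ⟨⟨m₀, h₀⟩, ⟨m₁, h₁⟩, ⟨m₃, h₃⟩, l₀₁, l₁₃, hn.mem, hn.notMem, ?_, ?_⟩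
  · exact (tp_mem_bs_succFrame_iff hs h0 l₁₃ _ _).2 ⟨B, hB, hnB⟩
  · exact (tp_mem_bs_succFrame_iff hs h0 ((s.succFrame lam).K.le_trans l₀₁ l₁₃) hn.mem
      fun h => hn.notMem (subset_of_le hn.le₀₁ h)).2 ⟨B, hB, nfGE_mid hs h0 hnB hB₀ hn.le₀₁⟩

theorem nfIso_succFrame : (s.succFrame lam).NfIso := by
  rintro f a M₀ M₁ M₃ N₀ N₁ N₃ h₀ h₁ h₃ ⟨hn, c₀, c₁, c₃⟩
  exact ⟨nfGE_iso hs h0 hn h₀ h₁ h₃, h₀.card_eq ▸ c₀, h₁.card_eq ▸ c₁, h₃.card_eq ▸ c₃⟩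

theorem monotonicity_succFrame : (s.succFrame lam).Monotonicity (Order.succ lam) := by
  rintro a M₀ M₀' M₁' M₁ M₃ M₃' M₃'' c₀ c₁ - c₃ h₀ h₀₁ h₁ - h₃ h₃' hsub ha ⟨hn, -⟩
  exact ⟨nfGE_mono hs h0 hn h₀.1 h₀₁.1 h₁.1 h₃.1 h₃'.1 hsub ha, c₀.2, c₁.2, c₃.2⟩

theorem localCharacter_succFrame : (s.succFrame lam).LocalCharacter (Order.succ lam) := by
  intro δ Ms _ hl hinc hc p hp
  obtain ⟨⟨N, a, h, ha, ha'⟩, rfl⟩ := Quot.exists_rep p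
  obtain ⟨B, hB, hn⟩ := (tp_mem_bs_succFrame_iff hs h0 h ha ha').1 hp
  obtain ⟨α, hα, hn'⟩ := exists_nfGE_of_isSuccLimit hs h0 hl
    ⟨fun α β h h' => (hinc.1 α β h h').1, hinc.2⟩
    ((Order.le_succ lam).trans (hc 0 zero_le).ge) hB hn
  exact ⟨α, hα, (doesNotFork_succFrame_iff hs h0 h ha ha').2 ⟨hn', hc α hα.le⟩⟩

theorem continuity_succFrame : (s.succFrame lam).Continuity (Order.succ lam) := by
  intro δ Ms _ hl hinc hc p hp
  obtain ⟨⟨N, a, h, ha, ha'⟩, rfl⟩ := Quot.exists_rep p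
  have hn : ∀ α < δ, s.nfGE lam (Ms 0) a (Ms α) N := fun α hα => by
    obtain ⟨hle, hd⟩ := hp α hα
    exact ((doesNotFork_succFrame_iff hs h0 ((s.succFrame lam).K.le_trans hle h) ha
      fun h => ha' (subset_of_le hle h)).1 hd).1
  have h0δ := hinc.1 0 δ zero_le (Order.lt_add_one_iff.2 le_rfl)
  obtain ⟨B, hB, hB0, hnB⟩ := nfGE_continuity hs h0 hl
    ⟨fun α β h h' => (hinc.1 α β h h').1, hinc.2⟩ h.1 hn
  exact ⟨(tp_mem_bs_succFrame_iff hs h0 h ha ha').2 ⟨B, hB, hnB⟩,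
    (doesNotFork_succFrame_iff hs h0 h ha ha').2 ⟨nfGE_base hs h0 hnB hB0 h0δ.1, hc 0 zero_le⟩⟩

theorem symmetry_succFrame (hcont : s.ContinuityOfIndependence lam 2) :
    (s.succFrame lam).Symmetry (Order.succ lam) := by
  rintro M₀ M₁ M₃ a₁ a₂ h₀₁ h₁₃ ha ha' c₀ c₁ c₃ hb ⟨hn₂, -⟩
  obtain ⟨B, hB, hn₁⟩ := (tp_mem_bs_succFrame_iff hs h0 _ _ _).1 hb
  obtain ⟨M₂, M₃', hM₂, hM₃', h1, h2, h3, ha₂, hn⟩ :=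
    nfGE_symmetry hs h0 hcont c₀.1 c₃.1 h₁₃.1 ha hB hn₁ hn₂
  exact ⟨M₂, M₃', ⟨hM₂, hM₂.2⟩, ⟨hM₃', hM₃'.2⟩, ⟨h1, c₀.2, hM₂.2⟩, ⟨h2, hM₂.2, hM₃'.2⟩,
    ⟨h3, c₃.2, hM₃'.2⟩, ha₂, hn, c₀.2, hM₂.2, hM₃'.2⟩

/-- Under tameness, a type over a model of cardinality `λ⁺` that does not fork over a small
submodel `B` is determined by its restriction to `B`. -/
theorem tp_eq_of_tame (ht : s.TameNonForking lam) (hB : s.K.MemCard lam B) (hBM : s.K.le B M)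
    (h₁ : (s.succFrame lam).K.le M M₁) (h₂ : (s.succFrame lam).K.le M M₂)
    (hn₁ : s.nfGE lam B a₁ M M₁) (hn₂ : s.nfGE lam B a₂ M M₂)
    (he : (tp hn₁.le₁₂ hn₁.mem hn₁.notMem).restrict hBM =
      (tp hn₂.le₁₂ hn₂.mem hn₂.notMem).restrict hBM) :
    tp h₁ hn₁.mem hn₁.notMem = tp h₂ hn₂.mem hn₂.notMem := by
  refine GType.ofAtCard_injective hs.lst hs.isAEC h0 (Order.le_succ lam) ?_
  exact ht M M₁ M₂ a₁ a₂ h₁.1 h₂.1 hn₁.mem hn₁.notMem hn₂.mem hn₂.notMem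
    ⟨(s.K.mem_of_le h₁.1).1, h₁.2.1⟩ ⟨(s.K.mem_of_le h₁.1).2, h₁.2.2⟩
    ⟨(s.K.mem_of_le h₂.1).2, h₂.2.2⟩ ⟨B, hBM, hB, he,
      (doesNotForkGE_tp_iff hs h0 _ _ _).2 hn₁, (doesNotForkGE_tp_iff hs h0 _ _ _).2 hn₂⟩

theorem uniqueness_succFrame (ht : s.TameNonForking lam) :
    (s.succFrame lam).Uniqueness (Order.succ lam) := by
  intro M N h hM hN p q hp hq he
  obtain ⟨⟨N₁, a₁, h₁, ha₁, ha₁'⟩, rfl⟩ := Quot.exists_rep p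
  obtain ⟨⟨N₂, a₂, h₂, ha₂, ha₂'⟩, rfl⟩ := Quot.exists_rep q
  have hn₁ := ((doesNotFork_succFrame_iff hs h0 h₁ ha₁ ha₁').1 hp).1
  have hn₂ := ((doesNotFork_succFrame_iff hs h0 h₂ ha₂ ha₂').1 hq).1
  obtain ⟨B₁, hB₁, hB₁M, hb₁⟩ := hn₁.exists_base
  obtain ⟨B₂, hB₂, hB₂M, hb₂⟩ := hn₂.exists_base
  obtain ⟨B, hB, hle₁, hle₂, hBM⟩ := exists_common hs h0 le_rfl hB₁ hB₂ hB₁M hB₂M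
  have hBN := s.K.le_trans hBM h.1
  refine tp_eq_of_tame hs h0 ht hB hBN h₁ h₂ (nfGE_base hs h0 hb₁ hle₁ hBN)
    (nfGE_base hs h0 hb₂ hle₂ hBN) ?_
  exact congrArg (fun r => GType.restrict hBM (GType.ofAtCard r)) he

theorem extension_succFrame (ht : s.TameNonForking lam) :
    (s.succFrame lam).Extension (Order.succ lam) := by
  intro M N h hM hN p hp
  obtain ⟨⟨M₁, a, h₁, ha, ha'⟩, rfl⟩ := Quot.exists_rep p
  obtain ⟨B, hB, hn⟩ := (tp_mem_bs_succFrame_iff hs h0 h₁ ha ha').1 hp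
  have hBM := hn.le₀₁
  have hBN := s.K.le_trans hBM h.1
  obtain ⟨C, hC, hBC, hCM, haC⟩ := exists_between_mem hs h0 le_rfl (s.K.le_trans hBM h₁.1) hB.2 ha
  have hnC := nfGE_of_top hs h0 (nfGE_mid hs h0 hn (s.K.le_refl hB.1) hBM) hBC hCM haC
  obtain ⟨-, -, -, -, hBC', haC', haB, hb, -⟩ :=
    hs.frame.nfBasic _ _ _ _ ((nfGE_iff_nf hs h0 hB hB hC).1 hnC)
  obtain ⟨P, b, hNP, hbP, hbB, hP, hnP, he⟩ :=
    exists_nfGE_extension hs h0 hN.1 hB hBN hC hBC haC haB hb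
  have hNP' : (s.succFrame lam).K.le N P := ⟨hNP, hN.2, hP.2⟩
  refine ⟨tp hNP' hnP.mem hnP.notMem, (tp_mem_bs_succFrame_iff hs h0 _ _ _).2 ⟨B, hB, hnP⟩,
    (doesNotFork_succFrame_iff hs h0 _ _ _).2 ⟨nfGE_base hs h0 hnP hBM h.1, hM.2⟩, ?_⟩
  refine tp_eq_of_tame hs h0 ht hB hBM ((s.succFrame lam).K.le_trans h hNP') h₁
    (nfGE_mid hs h0 hnP hBM h.1) hn ?_
  exact he.trans (tp_eq_of_le hBC (s.K.le_trans hBM h₁.1) hCM haC haB ha)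

/-- There are at most `λ⁺` basic types over a model of cardinality `λ⁺`: each is determined by its
restriction to some member of a filtration, over which it does not fork. -/
theorem basicStability_succFrame (ht : s.TameNonForking lam) :
    (s.succFrame lam).BasicStability (Order.succ lam) (Order.succ lam) := by
  intro M hM
  obtain ⟨B₀, hB₀, hB₀M⟩ := exists_small hs h0 hM.1.1 ((Order.le_succ lam).trans hM.2.ge)
  obtain ⟨Ms, hMs, -⟩ := hs.lst.exists_filtration hs.isAEC h0 hM.1 hB₀ hB₀M
  have hle := hMs.le hs.isAEC h0
  have hMc : ∀ α < (Order.succ lam).ord, s.K.MemCard lam (Ms α) := fun α hα =>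
    hMs.memCard hs.isAEC h0 hα
  have H : ∀ p : (s.succFrame lam).bs M, ∃ α : Set.Iio (Order.succ lam).ord,
      ∃ (N : SetModel L) (a : ZFSet.{u}) (h : (s.succFrame lam).K.le M N) (ha : a ∈ N.carrier)
        (ha' : a ∉ M.carrier), tp h ha ha' = p.1 ∧ s.nfGE lam (Ms α) a M N := by
    rintro ⟨p, hp⟩
    obtain ⟨⟨N, a, h, ha, ha'⟩, rfl⟩ := Quot.exists_rep p
    obtain ⟨B, hB, hn⟩ := (tp_mem_bs_succFrame_iff hs h0 h ha ha').1 hp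
    obtain ⟨α, hα, hBα⟩ := hMs.exists_le hs.isAEC h0 hB hn.le₀₁
    exact ⟨⟨α, hα⟩, N, a, h, ha, ha', rfl, nfGE_base hs h0 hn hBα (hle α hα)⟩
  choose α hα using H
  have hbs : ∀ p, GType.restrict (hle (α p) (α p).2) p.1.ofAtCard ∈ s.bs (Ms (α p)) := by
    intro p
    obtain ⟨N, a, h, ha, ha', he, hn⟩ := hα p
    have hMα := hMc _ (α p).2
    obtain ⟨P, hP, hMP, hPN, haP⟩ := exists_between_mem hs h0 le_rfl
      (s.K.le_trans hn.le₀₁ h.1) hMα.2 ha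
    have hn' := nfGE_of_top hs h0 (nfGE_mid hs h0 hn (s.K.le_refl hMα.1) hn.le₀₁) hMP hPN haP
    obtain ⟨-, -, -, -, h₁, h₂, h₃, hb, -⟩ :=
      hs.frame.nfBasic _ _ _ _ ((nfGE_iff_nf hs h0 hMα hMα hP).1 hn')
    rw [← he]
    rw [tp_eq_of_le h₁ (s.K.le_trans hn.le₀₁ h.1) hPN h₂ h₃ ha] at hb
    exact hb
  let F : (s.succFrame lam).bs M → Σ i : Set.Iio (Order.succ lam).ord, s.bs (Ms i) :=
    fun p => ⟨α p, _, hbs p⟩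
  have hF : Function.Injective F := by
    intro p q hpq
    have hαα : α p = α q := congrArg Sigma.fst hpq
    have hres : GType.restrict (hle (α p) (α p).2) p.1.ofAtCard =
        GType.restrict (hle (α p) (α p).2) q.1.ofAtCard := by
      have key : ∀ (i j : Set.Iio (Order.succ lam).ord) (hij : i = j)
          (x : s.bs (Ms i)) (y : s.bs (Ms j)),
          (⟨i, x⟩ : Σ i : Set.Iio (Order.succ lam).ord, s.bs (Ms i)) = ⟨j, y⟩ →
          ∀ r : s.K.GType M, y.1 = GType.restrict (hle j j.2) r →
            x.1 = GType.restrict (hle i i.2) r := by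
        rintro i _ rfl x y hxy r hr
        cases hxy
        exact hr
      exact key _ _ hαα _ _ hpq _ rfl
    obtain ⟨N₁, a₁, h₁, ha₁, ha₁', he₁, hn₁⟩ := hα p
    obtain ⟨N₂, a₂, h₂, ha₂, ha₂', he₂, hn₂⟩ := hα q
    rw [← hαα] at hn₂
    refine Subtype.ext ?_
    rw [← he₁, ← he₂] at hres ⊢
    exact tp_eq_of_tame hs h0 ht (hMc _ (α p).2) (hle _ (α p).2) h₁ h₂ hn₁ hn₂ hres
  refine (Cardinal.mk_le_of_injective hF).trans ?_
  rw [Cardinal.mk_sigma]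
  refine (Cardinal.sum_le_sum (fun i : Set.Iio (Order.succ lam).ord => #(s.bs (Ms i)))
    (fun _ => Cardinal.lift.{u + 1} (Order.succ lam))
    fun i => hs.frame.basicStability _ (hMc i i.2)).trans ?_
  rw [Cardinal.sum_const', Cardinal.mk_Iio_ordinal, Cardinal.card_ord]
  exact (Cardinal.mul_eq_self
    (Cardinal.aleph0_le_lift.2 (h0.trans (Order.le_succ lam)))).le

end IsSemiGoodFrame

end PreFrame

end AEC

theorem mainTheorem6 {L : FirstOrder.Language.{u, u}} (s : AEC.PreFrame.{u} L)
    (lam : Cardinal.{u}) (hlam : Cardinal.aleph0 ≤ lam) (hs : s.IsSemiGoodFrame lam)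
    (hcont : s.ContinuityOfIndependence lam 2) :
    (s.succFrame lam).Symmetry (Order.succ lam) ∧
      (s.TameNonForking lam → (s.succFrame lam).IsGoodFrameMinusJEPAP (Order.succ lam)) :=
  have hsymm := hs.symmetry_succFrame hlam hcont
  ⟨hsymm, fun ht =>
    { isAECIn := hs.isAECIn_succFrame hlam
      frame :=
        { noMaximal := fun M hM => by
            obtain ⟨N, hN, hle, hne⟩ := hs.noMaximal_succ hlam M hM.1
            exact ⟨N, ⟨hN, hN.2⟩, ⟨hle, hM.2, hN.2⟩, hne⟩
          basicIso := hs.basicIso_succFrame hlam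
          density := hs.density_succFrame hlam
          basicStability := hs.basicStability_succFrame hlam ht
          nfBasic := hs.nfBasic_succFrame hlam
          nfIso := hs.nfIso_succFrame hlam
          monotonicity := hs.monotonicity_succFrame hlam
          localCharacter := hs.localCharacter_succFrame hlam
          uniqueness := hs.uniqueness_succFrame hlam ht
          symmetry := hsymm
          extension := hs.extension_succFrame hlam ht
          continuity := hs.continuity_succFrame hlam } }⟩
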